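/- Let $\bar\theta\in(0,\pi/2)$, $\alpha>1$, and let $K=\{(x_1,x_2)\in\mathbb{R}^2 : x_1\le 0,\ x_1\cos\bar\theta+x_2\sin\bar\theta\le 0\}$, with $P_K$ the (nearest point) projection onto $K$. For $u,v\in\mathbb{R}^2$ put $$G(u,v)=\frac{\bigl(v\cdot(u-P_Ku)\bigr)(u-P_Ku)}{|u-P_Ku|^2}\ \text{ if } u\notin K,\qquad G(u,v)=0\ \text{ if } u\in K.$$ Fix $x_2(0)<0$, $\dot x_1(0)>0$, $\dot x_2(0)>0$, and set $u(0)=(0,x_2(0))$, $\dot u(0)=(\dot x_1(0),\dot x_2(0))$, $t_0=-x_2(0)/\dot x_2(0)$. For $k>0$ let $u_k:[0,\infty)\to\mathbb{R}^2$ be a solution of the penalized problem $$\ddot u_k+2\alpha\sqrt{k}\,G(u_k,\dot u_k)+k\,(u_k-P_Ku_k)=0,\qquad u_k(0)=u(0),\quad \dot u_k(0)=\dot u(0),$$ that is, $u_k$ is $C^1$ on $[0,\infty)$, $\dot u_k$ is locally absolutely continuous and the equation holds for almost every $t$. Let $\Pi_1$ and $\Pi_2$ be the orthogonal projections on the lines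 $\{x_1=0\}$ and $\{x_1\cos\bar\theta+x_2\sin\bar\theta=0\}$. Then such a $u_k$ exists for all sufficiently large $k$; for all sufficiently large $k$ one has $\Pi_1\dot u_k(t_0)=\Pi_1\dot u(0)$ (this common value is denoted $\Pi_1\dot u(t_0)$); and, as $k\to\infty$, $u_k$ converges uniformly on compact subsets of $[0,\infty)$ to $$u_\infty(t)=\begin{cases}u(0)+t\,\Pi_1\dot u(0)&\text{if } 0\le t\le t_0,\\ (t-t_0)\,\Pi_2\Pi_1\dot u(t_0)&\text{if } t\ge t_0.\end{cases}$$ -/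

import Mathlib

open Filter Topology MeasureTheory

noncomputable section

namespace CornerImpact

/-- The Euclidean plane. The coordinates written `x₁, x₂` below are `x 0, x 1`. -/
abbrev Plane : Type := EuclideanSpace ℝ (Fin 2)

/-- The angular domain `K`. -/
def cone (θ : ℝ) : Set Plane :=
  {x | x 0 ≤ 0 ∧ x 0 * Real.cos θ + x 1 * Real.sin θ ≤ 0}

/-- Every point of the plane has exactly one nearest point in `K`. -/
theorem existsUnique_nearest (θ : ℝ) (x : Plane) :
    ∃! y : Plane, y ∈ cone θ ∧ ∀ z ∈ cone θ, dist x y ≤ dist x z := by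
  have hcl : IsClosed (cone θ) := by
    have h0 : Continuous fun x : Plane => x 0 := by fun_prop
    have h1 : Continuous fun x : Plane => x 0 * Real.cos θ + x 1 * Real.sin θ := by fun_prop
    exact (isClosed_le h0 continuous_const).inter (isClosed_le h1 continuous_const)
  have hne : (cone θ).Nonempty := ⟨0, by simp [cone]⟩
  obtain ⟨y, hy, hxy⟩ := hcl.exists_infDist_eq_dist hne x
  have hmin : ∀ z ∈ cone θ, dist x y ≤ dist x z := fun z hz => by
    rw [← hxy]; exact Metric.infDist_le_dist_of_mem hz
  refine ⟨y, ⟨hy, hmin⟩, ?_⟩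
  rintro z ⟨hz, hzmin⟩
  have hd : dist x z = dist x y := le_antisymm (hzmin y hy) (hmin z hz)
  have hm : (1 / 2 : ℝ) • (y + z) ∈ cone θ := by
    obtain ⟨h1, h2⟩ := hy
    obtain ⟨h3, h4⟩ := hz
    constructor
    · simp only [PiLp.smul_apply, PiLp.add_apply, smul_eq_mul]; linarith
    · simp only [PiLp.smul_apply, PiLp.add_apply, smul_eq_mul]; linarith
  have h := hmin _ hm
  rw [dist_eq_norm, dist_eq_norm] at hd h
  have hpar := parallelogram_law_with_norm ℝ (x - y) (x - z)
  have e1 : (x - y) + (x - z) = (2 : ℝ) • (x - (1 / 2 : ℝ) • (y + z)) := by module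
  have e2 : (x - y) - (x - z) = z - y := by abel
  rw [e1, e2, norm_smul, hd] at hpar
  norm_num at hpar
  have h0 := norm_nonneg (x - y)
  have : ‖z - y‖ = 0 := by
    norm_num at h
    nlinarith [norm_nonneg (z - y), mul_self_le_mul_self h0 h]
  exact sub_eq_zero.mp (norm_eq_zero.mp this)

/-- The projection `P_K` onto `K`: the nearest point of `K`. -/
def projCone (θ : ℝ) (x : Plane) : Plane := (existsUnique_nearest θ x).choose

/-- The damping direction: `G(x, v) = (v · n) n / |n|²` with `n = x - P_K x` outside `K`,
and `0` on `K`. -/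
def damping (θ : ℝ) (x v : Plane) : Plane :=
  open Classical in
  if x ∈ cone θ then 0
  else (inner ℝ v (x - projCone θ x) / ‖x - projCone θ x‖ ^ 2) • (x - projCone θ x)

/-- `2 α √k G(x, v) + k (x - P_K x)`, so that the penalized equation reads
`ü + penaltyForce θ α k u u̇ = 0`. -/
def penaltyForce (θ α k : ℝ) (x v : Plane) : Plane :=
  (2 * α * √k) • damping θ x v + k • (x - projCone θ x)

/-- `u` is a solution on `[0, ∞)` of the penalized equation with stiffness `k`, starting at `u₀`
with velocity `v₀`. Since `G` is discontinuous across the boundary of `K`, where the motion starts,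
this is meant in the sense of Carathéodory: `u` is continuously differentiable on `[0, ∞)`
(one-sidedly at `0`), and its velocity `v` is an indefinite integral of `-penaltyForce` along `u`,
that is, `v` is locally absolutely continuous and satisfies the equation almost everywhere. -/
def IsPenaltySolution (θ α k : ℝ) (u₀ v₀ : Plane) (u : ℝ → Plane) : Prop :=
  u 0 = u₀ ∧
  ∃ v : ℝ → Plane,
    ContinuousOn v (Set.Ici 0) ∧
    (∀ t, 0 ≤ t → HasDerivWithinAt u (v t) (Set.Ici 0) t) ∧
    ∀ t, 0 ≤ t →
      IntervalIntegrable (fun s => penaltyForce θ α k (u s) (v s)) volume 0 t ∧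
      v t = v₀ - ∫ s in (0 : ℝ)..t, penaltyForce θ α k (u s) (v s)

/-- The line `{x₁ = 0}` carrying the first side of `K`. -/
def line₁ : Submodule ℝ Plane where
  carrier := {x | x 0 = 0}
  add_mem' := fun {a b} (ha : a 0 = 0) (hb : b 0 = 0) => by
    change (a + b) 0 = 0
    simp [ha, hb]
  zero_mem' := by simp
  smul_mem' := fun c a (ha : a 0 = 0) => by
    change (c • a) 0 = 0
    simp [ha]

/-- The line `{x₁ cos θ + x₂ sin θ = 0}` carrying the second side of `K`. -/
def line₂ (θ : ℝ) : Submodule ℝ Plane where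
  carrier := {x | x 0 * Real.cos θ + x 1 * Real.sin θ = 0}
  add_mem' := fun {a b} (ha : a 0 * Real.cos θ + a 1 * Real.sin θ = 0)
      (hb : b 0 * Real.cos θ + b 1 * Real.sin θ = 0) => by
    change (a + b) 0 * Real.cos θ + (a + b) 1 * Real.sin θ = 0
    simp only [PiLp.add_apply]
    linear_combination ha + hb
  zero_mem' := by simp
  smul_mem' := fun c a (ha : a 0 * Real.cos θ + a 1 * Real.sin θ = 0) => by
    change (c • a) 0 * Real.cos θ + (c • a) 1 * Real.sin θ = 0
    simp only [PiLp.smul_apply, smul_eq_mul]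
    linear_combination c * ha

/-- The orthogonal projection `Π₁` onto the first line. -/
def proj₁ : Plane →L[ℝ] Plane := line₁.starProjection

/-- The orthogonal projection `Π₂` onto the second line. -/
def proj₂ (θ : ℝ) : Plane →L[ℝ] Plane := (line₂ θ).starProjection

/-- The motion that starts at `u₀` with velocity `Π₁ v₀` and, from the time `t₀` on, leaves the
corner with velocity `Π₂ Π₁ v₀`. -/
def limitMotion (θ t₀ : ℝ) (u₀ v₀ : Plane) (t : ℝ) : Plane :=
  if t ≤ t₀ then u₀ + t • proj₁ v₀ else (t - t₀) • proj₂ θ (proj₁ v₀)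

end CornerImpact

end

/-!
Near each side of the corner the penalized equation decouples: the normal coordinate is an explicit
overdamped oscillator with decay rates of order `√k`, and the tangential velocity is constant.
The motion therefore slides along the first side up to the time `t₀`, when its height is that of the
apex, its distance `ε` from the apex satisfies `√k ε → 0` because it is exponentially small in `√k`,
and its velocity tends to `Π₁ v₀`.

Beyond the apex the direction of the force is not constant. But crossing this sector takes a time of
order `ε`, during which the force is of order `√k + k ε`, so the velocity changes by
`O(√k ε + (√k ε)²) → 0`. Rescaling positions by `ε`, the crossing is asymptotically the straight
motion `n₁ + s Π₁ v₀`, which reaches a position facing the second side while moving outwards and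
away from the apex. From such a state the normal coordinate of the second side stays positive, so
the motion slides along that side for all later times, with tangential velocity close to
`Π₂ Π₁ v₀`.
-/

namespace CornerImpact

open scoped InnerProductSpace

theorem mem_of_forall_not_first_exit {X : Type*} [TopologicalSpace X] {f : ℝ → X} {R : Set X}
    {a b : ℝ} (hf : ContinuousOn f (Set.Icc a b)) (hR : IsOpen R)
    (hstart : ∀ᶠ t in 𝓝[>] a, f t ∈ R)
    (hstep : ∀ t ∈ Set.Ioc a b, (∀ s ∈ Set.Ioo a t, f s ∈ R) → f t ∈ R) :
    ∀ t ∈ Set.Ioc a b, f t ∈ R := by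
  intro t ht
  by_contra hbad
  obtain ⟨c, hac, hc⟩ := (mem_nhdsGT_iff_exists_Ioo_subset' ht.1).1 hstart
  obtain ⟨d, had, hd⟩ := exists_between (lt_min (Set.mem_Ioi.1 hac) ht.1)
  have hcompact : IsCompact (Set.Icc d t ∩ f ⁻¹' Rᶜ) :=
    isCompact_Icc.of_isClosed_subset ((hf.mono (Set.Icc_subset_Icc had.le ht.2)
      ).preimage_isClosed_of_isClosed isClosed_Icc hR.isClosed_compl) Set.inter_subset_left
  obtain ⟨e, ⟨hde, heR⟩, hmin⟩ :=
    hcompact.exists_isLeast ⟨t, ⟨(hd.trans_le (min_le_right _ _)).le, le_rfl⟩, hbad⟩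
  refine heR (hstep e ⟨had.trans_le hde.1, hde.2.trans ht.2⟩ fun s hs => ?_)
  rcases lt_or_ge s d with hsd | hds
  · exact hc ⟨hs.1, hsd.trans (hd.trans_le (min_le_left _ _))⟩
  · by_contra hsR
    exact hs.2.not_ge (hmin ⟨⟨hds, hs.2.le.trans hde.2⟩, hsR⟩)

section Motion

variable {E : Type*} [NormedAddCommGroup E] [NormedSpace ℝ E]

/-- `u` moves on the time set `S` with velocity `v` against the force `F`, that is,
`ü + F(u, u̇) = 0` in the sense of Carathéodory: the equation for the velocity is taken in integral
form, since `F` need not be continuous along the motion. -/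
structure IsMotionOn (F : E → E → E) (S : Set ℝ) (u v : ℝ → E) : Prop where
  hasDerivWithinAt : ∀ t ∈ S, HasDerivWithinAt u (v t) S t
  continuousOn_vel : ContinuousOn v S
  intervalIntegrable : ∀ s ∈ S, ∀ t ∈ S, IntervalIntegrable (fun r => F (u r) (v r)) volume s t
  vel_sub : ∀ s ∈ S, ∀ t ∈ S, v t - v s = -∫ r in s..t, F (u r) (v r)

namespace IsMotionOn

variable {F G : E → E → E} {S T : Set ℝ} {u v u' v' : ℝ → E} {a b c : ℝ}

theorem continuousOn_pos (h : IsMotionOn F S u v) : ContinuousOn u S :=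
  fun t ht => (h.hasDerivWithinAt t ht).continuousWithinAt

theorem mono (h : IsMotionOn F S u v) (hTS : T ⊆ S) : IsMotionOn F T u v where
  hasDerivWithinAt t ht := (h.hasDerivWithinAt t (hTS ht)).mono hTS
  continuousOn_vel := h.continuousOn_vel.mono hTS
  intervalIntegrable s hs t ht := h.intervalIntegrable s (hTS hs) t (hTS ht)
  vel_sub s hs t ht := h.vel_sub s (hTS hs) t (hTS ht)

theorem of_basepoint {w : E} (hu : ∀ t ∈ S, HasDerivWithinAt u (v t) S t) (hv : ContinuousOn v S)
    (hint : ∀ t ∈ S, IntervalIntegrable (fun r => F (u r) (v r)) volume c t)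
    (hvel : ∀ t ∈ S, v t = w - ∫ r in c..t, F (u r) (v r)) : IsMotionOn F S u v where
  hasDerivWithinAt := hu
  continuousOn_vel := hv
  intervalIntegrable s hs t ht := (hint s hs).symm.trans (hint t ht)
  vel_sub s hs t ht := by
    rw [hvel s hs, hvel t ht, ← intervalIntegral.integral_interval_sub_left (hint t ht) (hint s hs)]
    abel

theorem congr (h : IsMotionOn F S u v) (hS : S.OrdConnected) (hu : Set.EqOn u' u S)
    (hv : Set.EqOn v' v S) : IsMotionOn F S u' v' := by
  have hforce {s t : ℝ} (hs : s ∈ S) (ht : t ∈ S) :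
      Set.EqOn (fun r => F (u' r) (v' r)) (fun r => F (u r) (v r)) (Set.uIcc s t) :=
    fun r hr => congrArg₂ F (hu (hS.uIcc_subset hs ht hr)) (hv (hS.uIcc_subset hs ht hr))
  refine ⟨fun t ht => ?_, h.continuousOn_vel.congr hv, fun s hs t ht => ?_, fun s hs t ht => ?_⟩
  · exact hv ht ▸ (h.hasDerivWithinAt t ht).congr_of_mem hu ht
  · exact (h.intervalIntegrable s hs t ht).congr
      ((hforce hs ht).symm.mono Set.uIoc_subset_uIcc)
  · rw [hv hs, hv ht, h.vel_sub s hs t ht, intervalIntegral.integral_congr (hforce hs ht)]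

theorem congr_force (h : IsMotionOn F S u v) (hS : S.OrdConnected)
    (hFG : ∀ t ∈ interior S, F (u t) (v t) = G (u t) (v t)) : IsMotionOn G S u v := by
  have hforce {s t : ℝ} (hs : s ∈ S) (ht : t ∈ S) :
      Set.EqOn (fun r => F (u r) (v r)) (fun r => G (u r) (v r)) (Set.uIoo s t) := fun r hr =>
    hFG r (interior_maximal (Set.uIoo_subset_uIcc_self.trans (hS.uIcc_subset hs ht))
      isOpen_Ioo hr)
  exact ⟨h.hasDerivWithinAt, h.continuousOn_vel,
    fun s hs t ht => (h.intervalIntegrable s hs t ht).congr_uIoo (hforce hs ht),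
    fun s hs t ht => by
      rw [h.vel_sub s hs t ht, intervalIntegral.integral_congr_uIoo (hforce hs ht)]⟩

theorem union_Icc_Ici (hab : a ≤ b) (h : IsMotionOn F (Set.Icc a b) u v)
    (h' : IsMotionOn F (Set.Ici b) u v) : IsMotionOn F (Set.Ici a) u v := by
  have hunion : Set.Icc a b ∪ Set.Ici b = Set.Ici a := Set.Icc_union_Ici_eq_Ici hab
  have hb : b ∈ Set.Icc a b := Set.right_mem_Icc.2 hab
  refine of_basepoint (c := b) (w := v b) (fun t ht => ?_) ?_ (fun t ht => ?_) fun t ht => ?_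
  · rcases lt_trichotomy t b with htb | rfl | hbt
    · exact (h.hasDerivWithinAt t ⟨ht, htb.le⟩).mono_of_mem_nhdsWithin
        (inter_mem_nhdsWithin _ (Iic_mem_nhds htb))
    · exact hunion ▸ (h.hasDerivWithinAt t hb).union (h'.hasDerivWithinAt t Set.self_mem_Ici)
    · exact (h'.hasDerivWithinAt t hbt.le).mono_of_mem_nhdsWithin
        (mem_nhdsWithin_of_mem_nhds (Ici_mem_nhds hbt))
  · exact hunion ▸
      h.continuousOn_vel.union_of_isClosed h'.continuousOn_vel isClosed_Icc isClosed_Ici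
  · rcases le_total t b with htb | hbt
    · exact h.intervalIntegrable b hb t ⟨ht, htb⟩
    · exact h'.intervalIntegrable b Set.self_mem_Ici t hbt
  · rw [sub_eq_add_neg, ← sub_eq_iff_eq_add']
    rcases le_total t b with htb | hbt
    · exact h.vel_sub b hb t ⟨ht, htb⟩
    · exact h'.vel_sub b Set.self_mem_Ici t hbt

theorem exists_extend (hab : a ≤ b) (h : IsMotionOn F (Set.Icc a b) u v)
    (h' : IsMotionOn F (Set.Ici b) u' v') (hu : u' b = u b) (hv : v' b = v b) :
    ∃ U V : ℝ → E, IsMotionOn F (Set.Ici a) U V ∧ U a = u a ∧ V a = v a := by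
  have hleft (f f' : ℝ → E) : Set.EqOn ((Set.Iic b).piecewise f f') f (Set.Icc a b) :=
    (Set.piecewise_eqOn _ _ _).mono fun _ ht => ht.2
  have hright {f f' : ℝ → E} (hb : f' b = f b) :
      Set.EqOn ((Set.Iic b).piecewise f f') f' (Set.Ici b) := fun t ht => by
    rcases (Set.mem_Ici.1 ht).eq_or_lt with rfl | hbt
    · rw [Set.piecewise_eq_of_mem _ _ _ Set.self_mem_Iic, hb]
    · exact Set.piecewise_eq_of_notMem _ _ _ hbt.not_ge
  exact ⟨_, _, (h.congr Set.ordConnected_Icc (hleft u u') (hleft v v')).union_Icc_Ici hab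
    (h'.congr Set.ordConnected_Ici (hright hu) (hright hv)),
    hleft u u' (Set.left_mem_Icc.2 hab), hleft v v' (Set.left_mem_Icc.2 hab)⟩

theorem of_hasDerivWithinAt [CompleteSpace E] (hS : S.OrdConnected)
    (hu : ∀ t ∈ S, HasDerivWithinAt u (v t) S t)
    (hv : ∀ t ∈ S, HasDerivWithinAt v (-F (u t) (v t)) S t)
    (hF : ContinuousOn (fun t => F (u t) (v t)) S) : IsMotionOn F S u v where
  hasDerivWithinAt := hu
  continuousOn_vel t ht := (hv t ht).continuousWithinAt
  intervalIntegrable s hs t ht := (hF.mono (hS.uIcc_subset hs ht)).intervalIntegrable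
  vel_sub s hs t ht := by
    have hst := hS.uIcc_subset hs ht
    rw [← intervalIntegral.integral_neg]
    refine (intervalIntegral.integral_eq_sub_of_hasDeriv_right
      (fun r hr => ((hv r (hst hr)).mono hst).continuousWithinAt) (fun r hr => ?_)
      (hF.mono hst).neg.intervalIntegrable).symm
    exact (((hv r (hst (Set.Ioo_subset_Icc_self hr))).mono hst).hasDerivAt
      (Icc_mem_nhds hr.1 hr.2)).hasDerivWithinAt

theorem hasDerivWithinAt_vel [CompleteSpace E] (h : IsMotionOn F (Set.Icc a b) u v)
    (hF : Continuous fun p : E × E => F p.1 p.2) {t : ℝ} (ht : t ∈ Set.Icc a b) :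
    HasDerivWithinAt v (-F (u t) (v t)) (Set.Icc a b) t := by
  have ha : a ∈ Set.Icc a b := Set.left_mem_Icc.2 (ht.1.trans ht.2)
  have : Fact (t ∈ Set.Icc a b) := ⟨ht⟩
  have hforce : ContinuousOn (fun r => F (u r) (v r)) (Set.Icc a b) :=
    hF.comp_continuousOn (h.continuousOn_pos.prodMk h.continuousOn_vel)
  have hint : HasDerivWithinAt (fun t => ∫ r in a..t, F (u r) (v r)) (F (u t) (v t))
      (Set.Icc a b) t :=
    intervalIntegral.integral_hasDerivWithinAt_right (h.intervalIntegrable a ha t ht)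
      (hforce.stronglyMeasurableAtFilter_nhdsWithin measurableSet_Icc t) (hforce t ht)
  refine (hint.const_sub (v a)).congr_of_mem (fun s hs => ?_) ht
  rw [sub_eq_add_neg, ← h.vel_sub a ha s hs, add_sub_cancel]

theorem eqOn_of_lipschitzWith [CompleteSpace E] {K : NNReal}
    (hF : LipschitzWith K fun p : E × E => F p.1 p.2) (h : IsMotionOn F (Set.Icc a b) u v)
    (h' : IsMotionOn F (Set.Icc a b) u' v') (hu : u a = u' a) (hv : v a = v' a) :
    Set.EqOn u u' (Set.Icc a b) ∧ Set.EqOn v v' (Set.Icc a b) := by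
  have hfield : LipschitzWith (max 1 K) fun p : E × E => (p.2, -F p.1 p.2) :=
    LipschitzWith.prod_snd.prodMk hF.neg
  have hderiv {u v : ℝ → E} (h : IsMotionOn F (Set.Icc a b) u v) :
      ∀ t ∈ Set.Ico a b, HasDerivWithinAt (fun t => (u t, v t)) (v t, -F (u t) (v t))
        (Set.Ici t) t := fun t ht =>
    have htab := Set.Ico_subset_Icc_self ht
    ((h.hasDerivWithinAt t htab).prodMk (h.hasDerivWithinAt_vel hF.continuous htab)
      ).mono_of_mem_nhdsWithin (Icc_mem_nhdsGE_of_mem ht)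
  have heq : Set.EqOn (fun t => (u t, v t)) (fun t => (u' t, v' t)) (Set.Icc a b) :=
    ODE_solution_unique_of_mem_Icc_right (s := fun _ => Set.univ)
      (fun _ _ => hfield.lipschitzOnWith) (h.continuousOn_pos.prodMk h.continuousOn_vel)
      (hderiv h) (fun _ _ => trivial) (h'.continuousOn_pos.prodMk h'.continuousOn_vel)
      (hderiv h') (fun _ _ => trivial) (Prod.ext hu hv)
  exact ⟨fun t ht => congrArg Prod.fst (heq ht), fun t ht => congrArg Prod.snd (heq ht)⟩

theorem deriv_pos (h : IsMotionOn F S u v) {t : ℝ} (hS : S ∈ 𝓝 t) : deriv u t = v t :=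
  ((h.hasDerivWithinAt t (mem_of_mem_nhds hS)).hasDerivAt hS).deriv

theorem norm_pos_sub_le (h : IsMotionOn F (Set.Icc a b) u v) {w : E} {σ : ℝ}
    (hv : ∀ s ∈ Set.Ico a b, ‖v s - w‖ ≤ σ) :
    ∀ t ∈ Set.Icc a b, ‖u t - (u a + (t - a) • w)‖ ≤ σ * (t - a) := by
  intro t ht
  have hderiv : ∀ t ∈ Set.Icc a b,
      HasDerivWithinAt (fun t => u t - (t - a) • w) (v t - w) (Set.Icc a b) t := fun t ht =>
    ((h.hasDerivWithinAt t ht).sub (((hasDerivAt_id t).sub_const a).smul_const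
      w).hasDerivWithinAt).congr_deriv (by rw [one_smul])
  have hle := norm_image_sub_le_of_norm_deriv_le_segment' hderiv hv t ht
  rwa [sub_self, zero_smul, sub_zero, sub_sub, add_comm] at hle

theorem norm_vel_sub_le {M : ℝ} (h : IsMotionOn F (Set.Icc a b) u v)
    (hF : ∀ s ∈ Set.Ioo a b, ‖F (u s) (v s)‖ ≤ M) (hab : a ≤ b) :
    ‖v b - v a‖ ≤ M * (b - a) := by
  rw [h.vel_sub a (Set.left_mem_Icc.2 hab) b (Set.right_mem_Icc.2 hab), norm_neg,
    ← abs_of_nonneg (sub_nonneg.2 hab)]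
  refine intervalIntegral.norm_integral_le_of_norm_le_const_ae ?_
  filter_upwards [Measure.ae_ne volume b] with s hsb hs
  rw [Set.uIoc_of_le hab] at hs
  exact hF s ⟨hs.1, lt_of_le_of_ne hs.2 hsb⟩

theorem norm_le_of_norm_vel_sub_le (h : IsMotionOn F (Set.Icc a b) u v) {w : E} {δ : ℝ}
    (hv : ∀ t ∈ Set.Icc a b, ‖v t - w‖ ≤ δ) (hδ : 0 ≤ δ) {t : ℝ} (ht : t ∈ Set.Icc a b) :
    ‖u t‖ ≤ ‖u a‖ + (b - a) * (‖w‖ + δ) := by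
  have hta : 0 ≤ t - a := sub_nonneg.2 ht.1
  have hdrift : ‖u a + (t - a) • w‖ ≤ ‖u a‖ + (t - a) * ‖w‖ :=
    (norm_add_le _ _).trans_eq (by rw [norm_smul, Real.norm_of_nonneg hta])
  have herror := h.norm_pos_sub_le (fun s hs => hv s (Set.Ico_subset_Icc_self hs)) t ht
  calc ‖u t‖ ≤ ‖u a‖ + (t - a) * (‖w‖ + δ) := by
        linarith [norm_sub_norm_le (u t) (u a + (t - a) • w)]
    _ ≤ ‖u a‖ + (b - a) * (‖w‖ + δ) := by gcongr; exact ht.2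

end IsMotionOn
end Motion

section Tube

variable {E : Type*} [NormedAddCommGroup E] [NormedSpace ℝ E]
  {F : E → E → E} {u v : ℝ → E} {x₀ v₀ : E} {a b A B T σ : ℝ}

/-- The states that a motion starting at `x₀` with velocity `v₀` can reach within a time `T` as long
as its velocity changes by at most `σ`. -/
def tube (T σ : ℝ) (x₀ v₀ : E) : Set (E × E) :=
  {p | ∃ t ∈ Set.Icc 0 T, ‖p.1 - (x₀ + t • v₀)‖ ≤ T * σ ∧ ‖p.2 - v₀‖ ≤ σ}

/-- The maximum of `A ‖v‖ + B ‖x‖`, the growth of the force, over the tube around a motion with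
initial distance `x` from the origin and initial speed `v`. -/
def tubeForce (A B T σ x v : ℝ) : ℝ := A * (v + σ) + B * (x + T * (v + σ))

theorem norm_force_le_tubeForce (hA : 0 ≤ A) (hB : 0 ≤ B)
    (hF : ∀ x v, ‖F x v‖ ≤ A * ‖v‖ + B * ‖x‖) {p : E × E} (hp : p ∈ tube T σ x₀ v₀) :
    ‖F p.1 p.2‖ ≤ tubeForce A B T σ ‖x₀‖ ‖v₀‖ := by
  obtain ⟨t, ht, hp₁, hp₂⟩ := hp
  have hvel : ‖p.2‖ ≤ ‖v₀‖ + σ := by linarith [norm_sub_norm_le p.2 v₀]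
  have hpos : ‖p.1‖ ≤ ‖x₀‖ + T * (‖v₀‖ + σ) :=
    calc ‖p.1‖ ≤ ‖x₀ + t • v₀‖ + T * σ := by linarith [norm_sub_norm_le p.1 (x₀ + t • v₀)]
      _ ≤ ‖x₀‖ + t * ‖v₀‖ + T * σ := by
          gcongr
          exact (norm_add_le _ _).trans_eq (by rw [norm_smul, Real.norm_of_nonneg ht.1])
      _ ≤ ‖x₀‖ + T * ‖v₀‖ + T * σ := by gcongr; exact ht.2
      _ = ‖x₀‖ + T * (‖v₀‖ + σ) := by ring
  exact (hF _ _).trans (by unfold tubeForce; gcongr)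

theorem IsMotionOn.mem_tube (h : IsMotionOn F (Set.Icc a b) u v) (hσ : 0 ≤ σ)
    (hv : ∀ s ∈ Set.Icc a b, ‖v s - v a‖ ≤ σ) {t : ℝ} (ht : t ∈ Set.Icc a b) :
    (u t, v t) ∈ tube (b - a) σ (u a) (v a) := by
  refine ⟨t - a, ⟨sub_nonneg.2 ht.1, sub_le_sub_right ht.2 a⟩, ?_, hv t ht⟩
  calc ‖u t - (u a + (t - a) • v a)‖ ≤ σ * (t - a) :=
        h.norm_pos_sub_le (fun s hs => hv s (Set.Ico_subset_Icc_self hs)) t ht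
    _ ≤ (b - a) * σ := by rw [mul_comm]; gcongr; exact ht.2

theorem tube_subset_tube {T' : ℝ} (hσ : 0 ≤ σ) (hT : T ≤ T') :
    tube T σ x₀ v₀ ⊆ tube T' σ x₀ v₀ := fun _ ⟨t, ht, hp₁, hp₂⟩ =>
  ⟨t, ⟨ht.1, ht.2.trans hT⟩, hp₁.trans (by gcongr), hp₂⟩

theorem IsMotionOn.norm_vel_sub_lt (h : IsMotionOn F (Set.Icc a b) u v) (hA : 0 ≤ A) (hB : 0 ≤ B)
    (hF : ∀ x v, ‖F x v‖ ≤ A * ‖v‖ + B * ‖x‖) (hσ₀ : 0 < σ)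
    (hσ : (b - a) * tubeForce A B (b - a) σ ‖u a‖ ‖v a‖ < σ) :
    ∀ t ∈ Set.Icc a b, ‖v t - v a‖ < σ := by
  intro t ht
  have hstart : ‖v a - v a‖ < σ := by simpa using hσ₀
  rcases ht.1.eq_or_lt with rfl | hat
  · exact hstart
  have hab : a < b := hat.trans_le ht.2
  have hopen : IsOpen {x : E | ‖x - v a‖ < σ} := isOpen_lt (by fun_prop) (by fun_prop)
  refine mem_of_forall_not_first_exit h.continuousOn_vel hopen ?_ (fun t ht hts => ?_) t
    ⟨hat, ht.2⟩
  · exact ((h.continuousOn_vel a (Set.left_mem_Icc.2 hab.le)).mono_of_mem_nhdsWithin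
      (Icc_mem_nhdsGT hab)).eventually_mem (hopen.mem_nhds hstart)
  have hforce : ∀ s ∈ Set.Ioo a t,
      ‖F (u s) (v s)‖ ≤ tubeForce A B (b - a) σ ‖u a‖ ‖v a‖ := fun s hs => by
    have hsb : s ≤ b := hs.2.le.trans ht.2
    refine norm_force_le_tubeForce hA hB hF (tube_subset_tube hσ₀.le (sub_le_sub_right hsb a)
      ((h.mono (Set.Icc_subset_Icc_right hsb)).mem_tube hσ₀.le (fun r hr => ?_)
        (Set.right_mem_Icc.2 hs.1.le)))
    rcases hr.1.eq_or_lt with rfl | har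
    · exact hstart.le
    · exact (hts r ⟨har, hr.2.trans_lt hs.2⟩).le
  have hpos : 0 ≤ tubeForce A B (b - a) σ ‖u a‖ ‖v a‖ := by
    have := sub_nonneg.2 hab.le
    unfold tubeForce
    positivity
  calc ‖v t - v a‖ ≤ tubeForce A B (b - a) σ ‖u a‖ ‖v a‖ * (t - a) :=
        (h.mono (Set.Icc_subset_Icc_right ht.2)).norm_vel_sub_le hforce ht.1.le
    _ ≤ (b - a) * tubeForce A B (b - a) σ ‖u a‖ ‖v a‖ := by
        rw [mul_comm]; gcongr; exact ht.2
    _ < σ := hσ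

/-- The state with coordinates `z` in the tube at time `t`, the unit ball being mapped into the
tube. -/
def tubeChart (T σ : ℝ) (x₀ v₀ : E) (t : ℝ) (z : E × E) : E × E :=
  (x₀ + t • v₀ + (T * σ) • z.1, v₀ + σ • z.2)

theorem tubeChart_mem_tube (hσ : 0 ≤ σ) {t : ℝ} (ht : t ∈ Set.Icc 0 T) {z : E × E}
    (hz : z ∈ Metric.closedBall 0 1) : tubeChart T σ x₀ v₀ t z ∈ tube T σ x₀ v₀ := by
  have hT : 0 ≤ T := ht.1.trans ht.2
  rw [mem_closedBall_zero_iff, Prod.norm_def, max_le_iff] at hz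
  refine ⟨t, ht, ?_, ?_⟩
  · rw [tubeChart, add_sub_cancel_left, norm_smul, Real.norm_of_nonneg (by positivity)]
    exact mul_le_of_le_one_right (by positivity) hz.1
  · rw [tubeChart, add_sub_cancel_left, norm_smul, Real.norm_of_nonneg hσ]
    exact mul_le_of_le_one_right hσ hz.2

theorem lipschitzWith_tubeChart (t : ℝ) :
    LipschitzWith (max ‖T * σ‖₊ ‖σ‖₊) (tubeChart T σ x₀ v₀ t) := by
  have hfst := (lipschitzWith_smul (T * σ)).comp (LipschitzWith.prod_fst (α := E) (β := E))
  have hsnd := (lipschitzWith_smul σ).comp (LipschitzWith.prod_snd (α := E) (β := E))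
  have h := ((isometry_add_left (x₀ + t • v₀)).lipschitz.comp hfst).prodMk
    ((isometry_add_left v₀).lipschitz.comp hsnd)
  simp only [one_mul, mul_one] at h
  exact h

/-- The vector field of `ü + F(u, u̇) = 0` in the coordinates `tubeChart`. -/
noncomputable def tubeField (F : E → E → E) (a T σ : ℝ) (x₀ v₀ : E) (t : ℝ) (z : E × E) : E × E :=
  (T⁻¹ • z.2, -(σ⁻¹ • F (tubeChart T σ x₀ v₀ (t - a) z).1 (tubeChart T σ x₀ v₀ (t - a) z).2))

theorem isPicardLindelof_tubeField (hab : a < b) (hσ : 0 < σ) {K : NNReal} {M : ℝ}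
    (hLip : LipschitzOnWith K (fun p : E × E => F p.1 p.2) (tube (b - a) σ x₀ v₀))
    (hM : ∀ p ∈ tube (b - a) σ x₀ v₀, ‖F p.1 p.2‖ ≤ M) (hMσ : (b - a) * M ≤ σ) :
    IsPicardLindelof (tubeField F a (b - a) σ x₀ v₀) (⟨a, Set.left_mem_Icc.2 hab.le⟩ : Set.Icc a b)
      0 1 0 (b - a)⁻¹.toNNReal
      (max (‖(b - a)⁻¹‖₊ * 1) (‖σ⁻¹‖₊ * (K * max ‖(b - a) * σ‖₊ ‖σ‖₊))) := by
  have hT : 0 < b - a := sub_pos.2 hab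
  have hmem {t : ℝ} (ht : t ∈ Set.Icc a b) {z : E × E} (hz : z ∈ Metric.closedBall 0 1) :
      tubeChart (b - a) σ x₀ v₀ (t - a) z ∈ tube (b - a) σ x₀ v₀ :=
    tubeChart_mem_tube hσ.le ⟨sub_nonneg.2 ht.1, sub_le_sub_right ht.2 a⟩ hz
  refine ⟨fun t ht => ?_, fun z hz => ?_, fun t ht z hz => ?_, ?_⟩
  · have hforce := hLip.comp (lipschitzWith_tubeChart (t - a)).lipschitzOnWith
      fun z hz => hmem ht hz
    exact ((lipschitzWith_smul (b - a)⁻¹).comp LipschitzWith.prod_snd).lipschitzOnWith.prodMk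
      ((lipschitzWith_smul σ⁻¹).comp_lipschitzOnWith hforce).neg
  · refine continuousOn_const.prodMk (ContinuousOn.neg (ContinuousOn.const_smul ?_ _))
    exact hLip.continuousOn.comp (f := fun t => tubeChart (b - a) σ x₀ v₀ (t - a) z)
      (by unfold tubeChart; fun_prop) fun t ht => hmem ht hz
  · rw [Real.coe_toNNReal _ (by positivity)]
    have hz₂ : ‖z.2‖ ≤ 1 := (norm_snd_le z).trans (mem_closedBall_zero_iff.1 hz)
    refine norm_prod_le_iff.2 ⟨?_, ?_⟩
    · rw [tubeField, norm_smul, Real.norm_of_nonneg (by positivity)]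
      exact mul_le_of_le_one_right (by positivity) hz₂
    · rw [tubeField, norm_neg, norm_smul, Real.norm_of_nonneg (by positivity), inv_mul_le_iff₀ hσ,
        le_mul_inv_iff₀ hT, mul_comm]
      exact (mul_le_mul_of_nonneg_left (hM _ (hmem ht hz)) hT.le).trans hMσ
  · rw [sub_self, max_eq_left hT.le, Real.coe_toNNReal _ (by positivity), inv_mul_cancel₀ hT.ne']
    simp

theorem exists_hasDerivWithinAt_continuousOn [CompleteSpace E] {f : ℝ → E → E} {tmin tmax : ℝ}
    {t₀ : Set.Icc tmin tmax} {x₀ x : E} {r₀ r L K : NNReal}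
    (hf : IsPicardLindelof f t₀ x₀ r₀ r L K) (hx : x ∈ Metric.closedBall x₀ r) :
    ∃ g : ℝ → E, g t₀ = x ∧
      (∀ t ∈ Set.Icc tmin tmax, HasDerivWithinAt g (f t (g t)) (Set.Icc tmin tmax) t) ∧
      ContinuousOn (fun t => f t (g t)) (Set.Icc tmin tmax) := by
  obtain ⟨γ, hγ⟩ := ODE.FunSpace.exists_isFixedPt_next hf hx
  refine ⟨γ.compProj, ?_, fun t ht => ?_, ODE.FunSpace.continuousOn_comp_compProj hf γ⟩
  · rw [ODE.FunSpace.compProj_val, ← hγ, ODE.FunSpace.next_apply₀]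
  · refine (ODE.hasDerivWithinAt_picard_Icc t₀.2 hf.continuousOn_uncurry
      γ.continuous_compProj.continuousOn (fun _ _ => γ.compProj_mem_closedBall hf.mul_max_le)
      x ht).congr_of_mem (fun s hs => ?_) ht
    rw [ODE.FunSpace.compProj_of_mem hs]
    exact (ODE.FunSpace.isFixedPt_next_iff hf hx).1 hγ ⟨s, hs⟩

theorem exists_isMotionOn_of_lipschitzOnWith_tube [CompleteSpace E] (hab : a < b) (hσ : 0 < σ)
    {K : NNReal} {M : ℝ}
    (hLip : LipschitzOnWith K (fun p : E × E => F p.1 p.2) (tube (b - a) σ x₀ v₀))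
    (hM : ∀ p ∈ tube (b - a) σ x₀ v₀, ‖F p.1 p.2‖ ≤ M) (hMσ : (b - a) * M ≤ σ) :
    ∃ u v : ℝ → E, IsMotionOn F (Set.Icc a b) u v ∧ u a = x₀ ∧ v a = v₀ := by
  obtain ⟨z, hza, hz, hcont⟩ := exists_hasDerivWithinAt_continuousOn
    (isPicardLindelof_tubeField hab hσ hLip hM hMσ) (Metric.mem_closedBall_self le_rfl)
  have hT : b - a ≠ 0 := (sub_pos.2 hab).ne'
  let p (t : ℝ) : E × E := tubeChart (b - a) σ x₀ v₀ (t - a) (z t)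
  have hza : z a = 0 := hza
  have hz₁ (t) (ht : t ∈ Set.Icc a b) :=
    (ContinuousLinearMap.fst ℝ E E).hasFDerivAt.comp_hasDerivWithinAt t (hz t ht)
  have hz₂ (t) (ht : t ∈ Set.Icc a b) :=
    (ContinuousLinearMap.snd ℝ E E).hasFDerivAt.comp_hasDerivWithinAt t (hz t ht)
  refine ⟨fun t => (p t).1, fun t => (p t).2,
    .of_hasDerivWithinAt Set.ordConnected_Icc (fun t ht => ?_) (fun t ht => ?_) ?_, ?_, ?_⟩
  · refine ((((((hasDerivAt_id t).sub_const a).smul_const v₀).const_add x₀).hasDerivWithinAt).add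
      ((hz₁ t ht).const_smul ((b - a) * σ))).congr_deriv ?_
    rw [ContinuousLinearMap.coe_fst', tubeField, smul_smul, mul_right_comm, mul_inv_cancel₀ hT,
      one_smul, one_mul]
    rfl
  · refine (((hz₂ t ht).const_smul σ).const_add v₀).congr_deriv ?_
    rw [ContinuousLinearMap.coe_snd', tubeField, smul_neg, smul_inv_smul₀ hσ.ne']
  · refine (hcont.snd.const_smul (-σ)).congr fun t _ => ?_
    simp only [tubeField, Pi.smul_apply]
    rw [smul_neg, neg_smul, neg_neg, smul_inv_smul₀ hσ.ne']
  · simp only [p, tubeChart, hza, sub_self, zero_smul, Prod.fst_zero, smul_zero, add_zero]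
  · simp only [p, tubeChart, hza, Prod.snd_zero, smul_zero, add_zero]

end Tube

section InnerProduct

variable {E : Type*} [NormedAddCommGroup E] [InnerProductSpace ℝ E]

theorem norm_le_norm_add_of_inner_nonneg {x y : E} (h : 0 ≤ ⟪x, y⟫_ℝ) : ‖x‖ ≤ ‖x + y‖ := by
  refine le_of_sq_le_sq ?_ (norm_nonneg _)
  rw [norm_add_sq_real]
  nlinarith [sq_nonneg ‖y‖]

/-- The component of `x` orthogonal to the unit vector `n`. -/
def tangentPart (n x : E) : E := x - ⟪n, x⟫_ℝ • n

theorem tangentPart_eq_starProjection {n : E} (hn : ‖n‖ = 1) (x : E) :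
    tangentPart n x = (ℝ ∙ n)ᗮ.starProjection x := by
  rw [tangentPart, Submodule.starProjection_orthogonal_val,
    Submodule.starProjection_unit_singleton ℝ hn]

theorem norm_tangentPart_le {n : E} (hn : ‖n‖ = 1) (x : E) : ‖tangentPart n x‖ ≤ ‖x‖ := by
  rw [tangentPart_eq_starProjection hn]
  exact Submodule.norm_starProjection_apply_le _ x

theorem inner_tangentPart_self {n : E} (hn : ‖n‖ = 1) (x : E) : ⟪n, tangentPart n x⟫_ℝ = 0 := by
  rw [tangentPart, inner_sub_right, inner_smul_right, inner_self_eq_one_of_norm_eq_one hn, mul_one,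
    sub_self]

theorem inner_tangentPart_of_inner_eq_zero {n τ : E} (hτ : ⟪τ, n⟫_ℝ = 0) (x : E) :
    ⟪τ, tangentPart n x⟫_ℝ = ⟪τ, x⟫_ℝ := by
  rw [tangentPart, inner_sub_right, inner_smul_right, hτ, mul_zero, sub_zero]

theorem tangentPart_of_inner_eq_zero {n x : E} (hx : ⟪n, x⟫_ℝ = 0) : tangentPart n x = x := by
  rw [tangentPart, hx, zero_smul, sub_zero]

theorem tangentPart_sub (n x y : E) :
    tangentPart n (x - y) = tangentPart n x - tangentPart n y := by
  simp only [tangentPart, inner_sub_right, sub_smul]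
  abel

theorem norm_tangentPart_motion_sub_le {n : E} (hn : ‖n‖ = 1) (x v w : E) {s r : ℝ} (hs : 0 ≤ s)
    (hr : 0 ≤ r) :
    ‖tangentPart n x + s • tangentPart n v - (s + r) • tangentPart n w‖
      ≤ ‖x‖ + s * ‖v - w‖ + r * ‖w‖ := by
  have hsplit : tangentPart n x + s • tangentPart n v - (s + r) • tangentPart n w
      = tangentPart n x + s • tangentPart n (v - w) - r • tangentPart n w := by
    rw [tangentPart_sub]; module
  have hsmul {c : ℝ} (hc : 0 ≤ c) (z : E) : ‖c • tangentPart n z‖ ≤ c * ‖z‖ := by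
    rw [norm_smul, Real.norm_of_nonneg hc]
    exact mul_le_mul_of_nonneg_left (norm_tangentPart_le hn z) hc
  rw [hsplit]
  exact (norm_sub_le _ _).trans (add_le_add ((norm_add_le _ _).trans
    (add_le_add (norm_tangentPart_le hn x) (hsmul hs _))) (hsmul hr w))

theorem smul_add_tangentPart (n x : E) : ⟪n, x⟫_ℝ • n + tangentPart n x = x :=
  add_sub_cancel _ _

theorem norm_starProjection_singleton_sub_self_le (n n' : E) :
    ‖(ℝ ∙ n).starProjection n' - n'‖ ≤ ‖n - n'‖ := by
  have h := Submodule.norm_starProjection_apply_le (ℝ ∙ n)ᗮ (n - n')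
  rwa [Submodule.starProjection_orthogonal_val, map_sub, Submodule.starProjection_eq_self_iff.2
    (Submodule.mem_span_singleton_self n), sub_sub_sub_cancel_left] at h

theorem norm_starProjection_singleton_le_of_inner_eq_zero {n n' z : E} (hn : n ≠ 0)
    (hz : ⟪n', z⟫_ℝ = 0) : ‖(ℝ ∙ n).starProjection z‖ ≤ ‖z‖ / ‖n‖ * ‖n - n'‖ := by
  have : 0 < ‖n‖ := norm_pos_iff.2 hn
  have hnz : ⟪n, z⟫_ℝ = ⟪n - n', z⟫_ℝ := by rw [inner_sub_left, hz, sub_zero]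
  calc ‖(ℝ ∙ n).starProjection z‖ = |⟪n - n', z⟫_ℝ| / ‖n‖ := by
        rw [Submodule.starProjection_singleton, hnz, norm_smul, RCLike.ofReal_real_eq_id, id_eq,
          norm_div, Real.norm_eq_abs, norm_pow, norm_norm]
        field_simp
    _ ≤ ‖n - n'‖ * ‖z‖ / ‖n‖ := by gcongr; exact abs_real_inner_le_norm _ _
    _ = ‖z‖ / ‖n‖ * ‖n - n'‖ := by ring

theorem norm_starProjection_singleton_sub_le {n n' v v' : E} {c M : ℝ} (hc : 0 < c) (hn : c ≤ ‖n‖)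
    (hn' : c ≤ ‖n'‖) (hv' : ‖v'‖ ≤ M) :
    ‖(ℝ ∙ n).starProjection v - (ℝ ∙ n').starProjection v'‖
      ≤ ‖v - v'‖ + 2 * M / c * ‖n - n'‖ := by
  have hM : 0 ≤ M := (norm_nonneg v').trans hv'
  obtain ⟨s, hs⟩ := Submodule.mem_span_singleton.1 ((ℝ ∙ n').starProjection_apply_mem v')
  let z := (ℝ ∙ n')ᗮ.starProjection v'
  have hz : ‖z‖ ≤ M := (Submodule.norm_starProjection_apply_le _ _).trans hv'
  have hv'z : v' = s • n' + z := by
    rw [hs]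
    exact sub_eq_iff_eq_add'.1 (Submodule.starProjection_orthogonal_val v').symm
  have hsn : |s| * c ≤ M :=
    calc |s| * c ≤ |s| * ‖n'‖ := by gcongr
      _ = ‖(ℝ ∙ n').starProjection v'‖ := by rw [← hs, norm_smul, Real.norm_eq_abs]
      _ ≤ M := (Submodule.norm_starProjection_apply_le _ _).trans hv'
  have hdecomp : (ℝ ∙ n).starProjection v - (ℝ ∙ n').starProjection v' =
      (ℝ ∙ n).starProjection (v - v') + s • ((ℝ ∙ n).starProjection n' - n')
        + (ℝ ∙ n).starProjection z := by
    rw [← hs, map_sub, hv'z, map_add, map_smul, smul_sub]; abel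
  calc _ ≤ ‖v - v'‖ + |s| * ‖n - n'‖ + ‖z‖ / ‖n‖ * ‖n - n'‖ := by
        rw [hdecomp]
        refine norm_add₃_le.trans ?_
        rw [norm_smul, Real.norm_eq_abs]
        gcongr
        · exact Submodule.norm_starProjection_apply_le _ _
        · exact norm_starProjection_singleton_sub_self_le n n'
        · exact norm_starProjection_singleton_le_of_inner_eq_zero (norm_pos_iff.1 (hc.trans_le hn))
            (Submodule.mem_orthogonal_singleton_iff_inner_right.1
              ((ℝ ∙ n')ᗮ.starProjection_apply_mem v'))
    _ ≤ ‖v - v'‖ + M / c * ‖n - n'‖ + M / c * ‖n - n'‖ := by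
        gcongr
        exact (le_div_iff₀ hc).2 hsn
    _ = ‖v - v'‖ + 2 * M / c * ‖n - n'‖ := by ring

end InnerProduct

section Oscillator

/-- The solution of `ÿ + (l + m) ẏ + l m y = 0` with `y(0) = y` and `ẏ(0) = w`, for `l ≠ m`. -/
noncomputable def dampedPos (l m y w t : ℝ) : ℝ :=
  y * Real.exp (-l * t) + (w + l * y) * ((Real.exp (-l * t) - Real.exp (-m * t)) / (m - l))

/-- The velocity of `dampedPos`. -/
noncomputable def dampedVel (l m y w t : ℝ) : ℝ :=
  (w + l * y) * Real.exp (-m * t) - l * dampedPos l m y w t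

variable {l m y w t : ℝ}

theorem dampedPos_zero (l m y w : ℝ) : dampedPos l m y w 0 = y := by simp [dampedPos]

theorem dampedVel_zero (l m y w : ℝ) : dampedVel l m y w 0 = w := by
  simp [dampedVel, dampedPos_zero]

theorem hasDerivAt_exp_mul (c t : ℝ) :
    HasDerivAt (fun t => Real.exp (c * t)) (c * Real.exp (c * t)) t := by
  simpa [mul_comm] using ((hasDerivAt_id t).const_mul c).exp

theorem hasDerivAt_dampedPos (hlm : l ≠ m) (y w t : ℝ) :
    HasDerivAt (dampedPos l m y w) (dampedVel l m y w t) t := by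
  have h := ((hasDerivAt_exp_mul (-l) t).const_mul y).add
    ((((hasDerivAt_exp_mul (-l) t).sub (hasDerivAt_exp_mul (-m) t)).div_const (m - l)).const_mul
      (w + l * y))
  refine h.congr_deriv ?_
  have : m - l ≠ 0 := sub_ne_zero.2 hlm.symm
  unfold dampedVel dampedPos
  field_simp
  ring

theorem hasDerivAt_dampedVel (hlm : l ≠ m) (y w t : ℝ) :
    HasDerivAt (dampedVel l m y w)
      (-((l + m) * dampedVel l m y w t + l * m * dampedPos l m y w t)) t := by
  have h := ((hasDerivAt_exp_mul (-m) t).const_mul (w + l * y)).sub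
    ((hasDerivAt_dampedPos hlm y w t).const_mul l)
  refine h.congr_deriv ?_
  unfold dampedVel
  ring

theorem dampedPos_pos (hl : 0 ≤ l) (hlm : l < m) (hy : 0 ≤ y) (hw : 0 < w) (ht : 0 < t) :
    0 < dampedPos l m y w t := by
  have hexp : Real.exp (-m * t) < Real.exp (-l * t) := Real.exp_lt_exp.2 (by nlinarith)
  have : 0 < (Real.exp (-l * t) - Real.exp (-m * t)) / (m - l) :=
    div_pos (sub_pos.2 hexp) (sub_pos.2 hlm)
  unfold dampedPos
  positivity

theorem dampedPos_nonneg (hl : 0 ≤ l) (hlm : l < m) (hy : 0 ≤ y) (hw : 0 < w) (ht : 0 ≤ t) :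
    0 ≤ dampedPos l m y w t := by
  rcases ht.eq_or_lt with rfl | ht
  · rwa [dampedPos_zero]
  · exact (dampedPos_pos hl hlm hy hw ht).le

theorem dampedPos_le (hl : 0 ≤ l) (hlm : l < m) (hy : 0 ≤ y) (hw : 0 ≤ w) :
    dampedPos l m y w t ≤ (y + (w + l * y) / (m - l)) * Real.exp (-l * t) := by
  have : 0 < m - l := sub_pos.2 hlm
  have hquot : (Real.exp (-l * t) - Real.exp (-m * t)) / (m - l)
      ≤ Real.exp (-l * t) / (m - l) := by
    gcongr
    linarith [Real.exp_pos (-m * t)]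
  calc dampedPos l m y w t
      ≤ y * Real.exp (-l * t) + (w + l * y) * (Real.exp (-l * t) / (m - l)) := by
        unfold dampedPos; gcongr
    _ = (y + (w + l * y) / (m - l)) * Real.exp (-l * t) := by ring

end Oscillator

section Slide

variable {E : Type*} [NormedAddCommGroup E] [InnerProductSpace ℝ E] {l m a : ℝ} {n τ x v : E}

/-- The force in the direction `n` under which the coordinate along `n` is an oscillator with
decay rates `l` and `m`. -/
def slideForce (l m : ℝ) (n x v : E) : E := ((l + m) * ⟪n, v⟫_ℝ + l * m * ⟪n, x⟫_ℝ) • n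

/-- The motion under `slideForce l m n` that starts at `x` with velocity `v`. -/
noncomputable def slidePos (l m : ℝ) (n x v : E) (t : ℝ) : E :=
  dampedPos l m ⟪n, x⟫_ℝ ⟪n, v⟫_ℝ t • n + (tangentPart n x + t • tangentPart n v)

/-- The velocity of `slidePos`. -/
noncomputable def slideVel (l m : ℝ) (n x v : E) (t : ℝ) : E :=
  dampedVel l m ⟪n, x⟫_ℝ ⟪n, v⟫_ℝ t • n + tangentPart n v

theorem slidePos_zero (l m : ℝ) (n x v : E) : slidePos l m n x v 0 = x := by
  rw [slidePos, dampedPos_zero, zero_smul, add_zero, smul_add_tangentPart]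

theorem slideVel_zero (l m : ℝ) (n x v : E) : slideVel l m n x v 0 = v := by
  rw [slideVel, dampedVel_zero, smul_add_tangentPart]

theorem inner_slidePos_normal (hn : ‖n‖ = 1) (l m : ℝ) (x v : E) (t : ℝ) :
    ⟪n, slidePos l m n x v t⟫_ℝ = dampedPos l m ⟪n, x⟫_ℝ ⟪n, v⟫_ℝ t := by
  simp only [slidePos, inner_add_right, inner_smul_right, inner_tangentPart_self hn,
    inner_self_eq_one_of_norm_eq_one hn, mul_one, mul_zero, add_zero]

theorem inner_slideVel_normal (hn : ‖n‖ = 1) (l m : ℝ) (x v : E) (t : ℝ) :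
    ⟪n, slideVel l m n x v t⟫_ℝ = dampedVel l m ⟪n, x⟫_ℝ ⟪n, v⟫_ℝ t := by
  simp only [slideVel, inner_add_right, inner_smul_right, inner_tangentPart_self hn,
    inner_self_eq_one_of_norm_eq_one hn, mul_one, add_zero]

theorem inner_slidePos_tangent (hτ : ⟪τ, n⟫_ℝ = 0) (l m : ℝ) (x v : E) (t : ℝ) :
    ⟪τ, slidePos l m n x v t⟫_ℝ = ⟪τ, x⟫_ℝ + t * ⟪τ, v⟫_ℝ := by
  simp only [slidePos, inner_add_right, inner_smul_right, hτ,
    inner_tangentPart_of_inner_eq_zero hτ, mul_zero, zero_add]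

theorem hasDerivAt_slidePos (hlm : l ≠ m) (n x v : E) (t : ℝ) :
    HasDerivAt (slidePos l m n x v) (slideVel l m n x v t) t :=
  (((hasDerivAt_dampedPos hlm _ _ t).smul_const n).add
    (((hasDerivAt_id t).smul_const (tangentPart n v)).const_add (tangentPart n x))).congr_deriv
    (by rw [one_smul, slideVel])

theorem hasDerivAt_slideVel (hlm : l ≠ m) (hn : ‖n‖ = 1) (x v : E) (t : ℝ) :
    HasDerivAt (slideVel l m n x v)
      (-slideForce l m n (slidePos l m n x v t) (slideVel l m n x v t)) t :=
  (((hasDerivAt_dampedVel hlm _ _ t).smul_const n).add_const (tangentPart n v)).congr_deriv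
    (by rw [slideForce, inner_slidePos_normal hn, inner_slideVel_normal hn, neg_smul])

theorem isMotionOn_slide [CompleteSpace E] (hlm : l ≠ m) (hn : ‖n‖ = 1) (a : ℝ) (x v : E)
    {S : Set ℝ} (hS : S.OrdConnected) :
    IsMotionOn (slideForce l m n) S (fun t => slidePos l m n x v (t - a))
      (fun t => slideVel l m n x v (t - a)) := by
  have hpos (t : ℝ) := (hasDerivAt_slidePos hlm n x v (t - a)).comp_sub_const t a
  have hvel (t : ℝ) := (hasDerivAt_slideVel hlm hn x v (t - a)).comp_sub_const t a
  have hcpos : Continuous fun t => slidePos l m n x v (t - a) :=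
    continuous_iff_continuousAt.2 fun t => (hpos t).continuousAt
  have hcvel : Continuous fun t => slideVel l m n x v (t - a) :=
    continuous_iff_continuousAt.2 fun t => (hvel t).continuousAt
  refine .of_hasDerivWithinAt hS (fun t _ => (hpos t).hasDerivWithinAt)
    (fun t _ => (hvel t).hasDerivWithinAt) (Continuous.continuousOn ?_)
  unfold slideForce
  fun_prop

theorem exists_lipschitzWith_slideForce (l m : ℝ) (n : E) :
    ∃ K, LipschitzWith K fun p : E × E => slideForce l m n p.1 p.2 :=
  ⟨_, (((l + m) • (innerSL ℝ n ∘L .snd ℝ E E) + (l * m) • (innerSL ℝ n ∘L .fst ℝ E E)).smulRight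
    n).lipschitz⟩

theorem IsMotionOn.eqOn_slide [CompleteSpace E] {u v : ℝ → E} {b : ℝ} (hlm : l ≠ m)
    (hn : ‖n‖ = 1) (h : IsMotionOn (slideForce l m n) (Set.Icc a b) u v) :
    Set.EqOn u (fun t => slidePos l m n (u a) (v a) (t - a)) (Set.Icc a b) ∧
      Set.EqOn v (fun t => slideVel l m n (u a) (v a) (t - a)) (Set.Icc a b) := by
  obtain ⟨K, hK⟩ := exists_lipschitzWith_slideForce l m n
  exact h.eqOn_of_lipschitzWith hK (isMotionOn_slide hlm hn a (u a) (v a) Set.ordConnected_Icc)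
    (by simp only [sub_self, slidePos_zero]) (by simp only [sub_self, slideVel_zero])

theorem norm_slidePos_sub_le (hl : 0 ≤ l) (hlm : l < m) (hn : ‖n‖ = 1) (hx : 0 ≤ ⟪n, x⟫_ℝ)
    (hv : 0 < ⟪n, v⟫_ℝ) {t : ℝ} (ht : 0 ≤ t) :
    ‖slidePos l m n x v t - (tangentPart n x + t • tangentPart n v)‖
      ≤ m / (m - l) * ⟪n, x⟫_ℝ + ⟪n, v⟫_ℝ / (m - l) := by
  have hml : 0 < m - l := sub_pos.2 hlm
  rw [slidePos, add_sub_cancel_right, norm_smul, hn, mul_one,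
    Real.norm_of_nonneg (dampedPos_nonneg hl hlm hx hv ht)]
  calc _ ≤ (⟪n, x⟫_ℝ + (⟪n, v⟫_ℝ + l * ⟪n, x⟫_ℝ) / (m - l)) * Real.exp (-l * t) :=
        dampedPos_le hl hlm hx hv.le
    _ ≤ ⟪n, x⟫_ℝ + (⟪n, v⟫_ℝ + l * ⟪n, x⟫_ℝ) / (m - l) :=
        mul_le_of_le_one_right (by positivity) (Real.exp_le_one_iff.2 (by nlinarith))
    _ = m / (m - l) * ⟪n, x⟫_ℝ + ⟪n, v⟫_ℝ / (m - l) := by field_simp; ring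

end Slide

section Cone

variable {θ α k : ℝ} {x v : Plane}

theorem projCone_mem (θ : ℝ) (x : Plane) : projCone θ x ∈ cone θ :=
  (existsUnique_nearest θ x).choose_spec.1.1

theorem dist_projCone_le (x : Plane) {z : Plane} (hz : z ∈ cone θ) :
    dist x (projCone θ x) ≤ dist x z :=
  (existsUnique_nearest θ x).choose_spec.1.2 z hz

theorem projCone_eq {y : Plane} (hy : y ∈ cone θ) (h : ∀ z ∈ cone θ, dist x y ≤ dist x z) :
    projCone θ x = y :=
  ((existsUnique_nearest θ x).choose_spec.2 y ⟨hy, h⟩).symm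

theorem projCone_eq_self (hx : x ∈ cone θ) : projCone θ x = x :=
  projCone_eq hx fun z _ => by rw [dist_self]; exact dist_nonneg

theorem zero_mem_cone (θ : ℝ) : (0 : Plane) ∈ cone θ := by simp [cone]

theorem convex_cone (θ : ℝ) : Convex ℝ (cone θ) := by
  rintro x ⟨hx, hx'⟩ y ⟨hy, hy'⟩ a b ha hb -
  constructor <;> simp only [PiLp.smul_apply, PiLp.add_apply, smul_eq_mul]
  · nlinarith
  · nlinarith [mul_nonneg ha (neg_nonneg.2 hx'), mul_nonneg hb (neg_nonneg.2 hy')]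

theorem norm_sub_projCone_le (θ : ℝ) (x : Plane) : ‖x - projCone θ x‖ ≤ ‖x‖ := by
  simpa only [dist_eq_norm, sub_zero] using dist_projCone_le x (zero_mem_cone θ)

theorem inner_sub_projCone_le (x : Plane) {z : Plane} (hz : z ∈ cone θ) :
    ⟪x - projCone θ x, z - projCone θ x⟫_ℝ ≤ 0 := by
  have : Nonempty (cone θ) := ⟨⟨z, hz⟩⟩
  have hbdd : BddBelow (Set.range fun w : cone θ => ‖x - w‖) :=
    ⟨0, Set.forall_mem_range.2 fun w => norm_nonneg _⟩
  have hmin : ‖x - projCone θ x‖ = ⨅ w : cone θ, ‖x - w‖ :=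
    le_antisymm (le_ciInf fun w => by simpa only [dist_eq_norm] using dist_projCone_le x w.2)
      (ciInf_le hbdd ⟨projCone θ x, projCone_mem θ x⟩)
  exact (norm_eq_iInf_iff_real_inner_le_zero (convex_cone θ) (projCone_mem θ x)).1 hmin z hz

theorem norm_sub_projCone_sub_le (θ : ℝ) (x y : Plane) :
    ‖(x - projCone θ x) - (y - projCone θ y)‖ ≤ ‖x - y‖ := by
  have hinner : 0 ≤ ⟪(x - projCone θ x) - (y - projCone θ y), projCone θ x - projCone θ y⟫_ℝ := by
    have hx := inner_sub_projCone_le x (projCone_mem θ y)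
    have hy := inner_sub_projCone_le y (projCone_mem θ x)
    rw [← neg_sub (projCone θ x) (projCone θ y), inner_neg_right] at hx
    rw [inner_sub_left]
    linarith
  calc _ ≤ ‖((x - projCone θ x) - (y - projCone θ y)) + (projCone θ x - projCone θ y)‖ :=
        norm_le_norm_add_of_inner_nonneg hinner
    _ = ‖x - y‖ := by congr 1; abel

theorem damping_eq (θ : ℝ) (x v : Plane) :
    damping θ x v = (ℝ ∙ (x - projCone θ x)).starProjection v := by
  rw [Submodule.starProjection_singleton, damping]
  split_ifs with hx
  · rw [projCone_eq_self hx, sub_self, smul_zero]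
  · rw [real_inner_comm]; rfl

theorem norm_damping_le (θ : ℝ) (x v : Plane) : ‖damping θ x v‖ ≤ ‖v‖ := by
  rw [damping_eq]
  exact Submodule.norm_starProjection_apply_le _ v

theorem norm_penaltyForce_le (hα : 0 ≤ α) (hk : 0 ≤ k) (θ : ℝ) (x v : Plane) :
    ‖penaltyForce θ α k x v‖ ≤ 2 * α * √k * ‖v‖ + k * ‖x‖ := by
  refine (norm_add_le _ _).trans ?_
  rw [norm_smul, norm_smul, Real.norm_of_nonneg (by positivity), Real.norm_of_nonneg hk]
  gcongr
  · exact norm_damping_le θ x v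
  · exact norm_sub_projCone_le θ x

theorem exists_lipschitzOnWith_penaltyForce (hα : 0 ≤ α) (hk : 0 ≤ k) {c M : ℝ} (hc : 0 < c)
    {S : Set (Plane × Plane)} (hpos : ∀ p ∈ S, c ≤ ‖p.1 - projCone θ p.1‖)
    (hvel : ∀ p ∈ S, ‖p.2‖ ≤ M) :
    ∃ K, LipschitzOnWith K (fun p : Plane × Plane => penaltyForce θ α k p.1 p.2) S := by
  refine ⟨(2 * α * √k * (1 + 2 * M / c) + k).toNNReal,
    LipschitzOnWith.of_dist_le' fun p hp q hq => ?_⟩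
  have hM : 0 ≤ M := (norm_nonneg _).trans (hvel p hp)
  have hdamping : ‖damping θ p.1 p.2 - damping θ q.1 q.2‖ ≤ (1 + 2 * M / c) * ‖p - q‖ := by
    rw [damping_eq, damping_eq, add_mul, one_mul]
    refine (norm_starProjection_singleton_sub_le hc (hpos p hp) (hpos q hq) (hvel q hq)).trans ?_
    gcongr
    · exact norm_snd_le (p - q)
    · exact (norm_sub_projCone_sub_le θ p.1 q.1).trans (norm_fst_le (p - q))
  have hresidual : ‖(p.1 - projCone θ p.1) - (q.1 - projCone θ q.1)‖ ≤ ‖p - q‖ :=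
    (norm_sub_projCone_sub_le θ p.1 q.1).trans (norm_fst_le (p - q))
  rw [dist_eq_norm, dist_eq_norm, penaltyForce, penaltyForce, add_sub_add_comm, ← smul_sub,
    ← smul_sub]
  refine (norm_add_le _ _).trans ?_
  rw [norm_smul, norm_smul, Real.norm_of_nonneg (by positivity), Real.norm_of_nonneg hk, add_mul,
    mul_assoc _ (1 + 2 * M / c)]
  gcongr

end Cone

section Solution

theorem isPenaltySolution_iff {θ α k : ℝ} {u₀ v₀ : Plane} {u : ℝ → Plane} :
    IsPenaltySolution θ α k u₀ v₀ u ↔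
      ∃ v, IsMotionOn (penaltyForce θ α k) (Set.Ici 0) u v ∧ u 0 = u₀ ∧ v 0 = v₀ := by
  constructor
  · rintro ⟨hu₀, v, hv, hu, hforce⟩
    exact ⟨v, .of_basepoint hu hv (fun t ht => (hforce t ht).1) fun t ht => (hforce t ht).2,
      hu₀, by rw [(hforce 0 le_rfl).2, intervalIntegral.integral_same, sub_zero]⟩
  · rintro ⟨v, h, hu₀, hv₀⟩
    refine ⟨hu₀, v, h.continuousOn_vel, h.hasDerivWithinAt, fun t ht =>
      ⟨h.intervalIntegrable 0 Set.self_mem_Ici t ht, ?_⟩⟩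
    rw [← hv₀, sub_eq_add_neg, ← h.vel_sub 0 Set.self_mem_Ici t ht, add_sub_cancel]

end Solution

section Rates

/-- The slow decay rate of the normal coordinate, a root of `z ^ 2 - 2 * α * √k * z + k`. -/
noncomputable def slowRate (α k : ℝ) : ℝ := (α - √(α ^ 2 - 1)) * √k

/-- The fast decay rate of the normal coordinate, the other root of `z ^ 2 - 2 * α * √k * z + k`. -/
noncomputable def fastRate (α k : ℝ) : ℝ := (α + √(α ^ 2 - 1)) * √k

variable {α k : ℝ}

theorem sqrt_sq_sub_one_pos (hα : 1 < α) : 0 < √(α ^ 2 - 1) := Real.sqrt_pos.2 (by nlinarith)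

theorem sqrt_sq_sub_one_lt (hα : 1 < α) : √(α ^ 2 - 1) < α :=
  (Real.sqrt_lt' (by linarith)).2 (by linarith)

theorem slowRate_pos (hα : 1 < α) (hk : 0 < k) : 0 < slowRate α k :=
  mul_pos (sub_pos.2 (sqrt_sq_sub_one_lt hα)) (Real.sqrt_pos.2 hk)

theorem fastRate_sub_slowRate (α k : ℝ) :
    fastRate α k - slowRate α k = 2 * √(α ^ 2 - 1) * √k := by
  unfold fastRate slowRate; ring

theorem slowRate_lt_fastRate (hα : 1 < α) (hk : 0 < k) : slowRate α k < fastRate α k := by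
  have := sqrt_sq_sub_one_pos hα
  have := Real.sqrt_pos.2 hk
  rw [← sub_pos, fastRate_sub_slowRate]
  positivity

theorem slowRate_add_fastRate (α k : ℝ) : slowRate α k + fastRate α k = 2 * α * √k := by
  unfold fastRate slowRate; ring

theorem slowRate_mul_fastRate (hα : 1 < α) (hk : 0 ≤ k) : slowRate α k * fastRate α k = k := by
  have hα' := Real.sq_sqrt (show 0 ≤ α ^ 2 - 1 by nlinarith)
  have hk' := Real.sq_sqrt hk
  unfold fastRate slowRate
  linear_combination hk' - √k ^ 2 * hα'

end Rates

section Side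

variable {θ α k : ℝ} {n τ x : Plane}

/-- `n` is the unit outer normal of a side of the cone and `τ` a vector along that side pointing
away from the apex. -/
structure IsSide (θ : ℝ) (n τ : Plane) : Prop where
  norm_normal : ‖n‖ = 1
  inner_tangent_normal : ⟪τ, n⟫_ℝ = 0
  mem_cone : ∀ z, ⟪n, z⟫_ℝ = 0 → 0 ≤ ⟪τ, z⟫_ℝ → z ∈ cone θ
  inner_nonpos : ∀ z ∈ cone θ, ⟪n, z⟫_ℝ ≤ 0

theorem IsSide.inner_sub_le_norm (h : IsSide θ n τ) (x : Plane) {z : Plane} (hz : z ∈ cone θ) :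
    ⟪n, x⟫_ℝ ≤ ‖x - z‖ :=
  calc ⟪n, x⟫_ℝ ≤ ⟪n, x - z⟫_ℝ := by rw [inner_sub_right]; linarith [h.inner_nonpos z hz]
    _ ≤ ‖x - z‖ := by simpa only [h.norm_normal, one_mul] using real_inner_le_norm n (x - z)

theorem IsSide.projCone_eq_tangentPart (h : IsSide θ n τ) (hn : 0 ≤ ⟪n, x⟫_ℝ)
    (hτ : 0 ≤ ⟪τ, x⟫_ℝ) : projCone θ x = tangentPart n x := by
  refine projCone_eq (h.mem_cone _ (inner_tangentPart_self h.norm_normal x) ?_) fun z hz => ?_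
  · rwa [inner_tangentPart_of_inner_eq_zero h.inner_tangent_normal]
  · rw [dist_eq_norm, dist_eq_norm, tangentPart, sub_sub_cancel, norm_smul, h.norm_normal, mul_one,
      Real.norm_of_nonneg hn]
    exact h.inner_sub_le_norm x hz

theorem IsSide.penaltyForce_eq (h : IsSide θ n τ) (hα : 1 < α) (hk : 0 ≤ k)
    (hn : 0 < ⟪n, x⟫_ℝ) (hτ : 0 ≤ ⟪τ, x⟫_ℝ) (v : Plane) :
    penaltyForce θ α k x v = slideForce (slowRate α k) (fastRate α k) n x v := by
  simp only [penaltyForce, damping_eq, h.projCone_eq_tangentPart hn.le hτ, tangentPart,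
    sub_sub_cancel,
    Submodule.span_singleton_smul_eq hn.ne'.isUnit,
    Submodule.starProjection_unit_singleton ℝ h.norm_normal, slideForce, slowRate_add_fastRate,
    slowRate_mul_fastRate hα hk]
  module

theorem inner_pair (a b : ℝ) (x : Plane) : ⟪!₂[a, b], x⟫_ℝ = x 0 * a + x 1 * b := by
  simp [PiLp.inner_apply, Fin.sum_univ_two]

/-- The unit outer normal of the first side. -/
noncomputable def normal₁ : Plane := !₂[1, 0]

/-- The unit vector along the first side pointing away from the apex. -/
noncomputable def tangent₁ : Plane := !₂[0, -1]

/-- The unit outer normal of the second side. -/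
noncomputable def normal₂ (θ : ℝ) : Plane := !₂[Real.cos θ, Real.sin θ]

/-- The unit vector along the second side pointing away from the apex. -/
noncomputable def tangent₂ (θ : ℝ) : Plane := !₂[-Real.sin θ, Real.cos θ]

theorem inner_normal₁ (x : Plane) : ⟪normal₁, x⟫_ℝ = x 0 := by simp [normal₁, inner_pair]

theorem inner_tangent₁ (x : Plane) : ⟪tangent₁, x⟫_ℝ = -x 1 := by simp [tangent₁, inner_pair]

theorem inner_normal₂ (θ : ℝ) (x : Plane) :
    ⟪normal₂ θ, x⟫_ℝ = x 0 * Real.cos θ + x 1 * Real.sin θ := inner_pair _ _ x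

theorem inner_tangent₂ (θ : ℝ) (x : Plane) :
    ⟪tangent₂ θ, x⟫_ℝ = x 1 * Real.cos θ - x 0 * Real.sin θ := by
  rw [tangent₂, inner_pair]; ring

theorem norm_normal₁ : ‖normal₁‖ = 1 := by simp [normal₁, EuclideanSpace.norm_eq]

theorem norm_normal₂ (θ : ℝ) : ‖normal₂ θ‖ = 1 := by simp [normal₂, EuclideanSpace.norm_eq]

theorem isSide₁ (hθ : 0 ≤ Real.sin θ) : IsSide θ normal₁ tangent₁ where
  norm_normal := norm_normal₁
  inner_tangent_normal := by simp [inner_tangent₁, normal₁]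
  mem_cone z hn hτ := by
    rw [inner_normal₁] at hn
    rw [inner_tangent₁] at hτ
    exact ⟨hn.le, by rw [hn]; nlinarith⟩
  inner_nonpos z hz := (inner_normal₁ z).trans_le hz.1

theorem isSide₂ (hθ : 0 ≤ Real.sin θ) : IsSide θ (normal₂ θ) (tangent₂ θ) where
  norm_normal := norm_normal₂ θ
  inner_tangent_normal := by simp [inner_tangent₂, normal₂]; ring
  mem_cone z hn hτ := by
    rw [inner_normal₂] at hn
    rw [inner_tangent₂] at hτ
    refine ⟨?_, hn.le⟩
    -- `z` is the multiple `⟪τ, z⟫` of `τ`, whose first coordinate is `-sin θ`.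
    have hz : z 0 = -(z 1 * Real.cos θ - z 0 * Real.sin θ) * Real.sin θ := by
      linear_combination Real.cos θ * hn - z 0 * Real.sin_sq_add_cos_sq θ
    nlinarith
  inner_nonpos z hz := (inner_normal₂ θ z).trans_le hz.2

theorem line₁_eq : line₁ = (ℝ ∙ normal₁)ᗮ := by
  ext x
  rw [Submodule.mem_orthogonal_singleton_iff_inner_right, inner_normal₁]
  rfl

theorem line₂_eq (θ : ℝ) : line₂ θ = (ℝ ∙ normal₂ θ)ᗮ := by
  ext x
  rw [Submodule.mem_orthogonal_singleton_iff_inner_right, inner_normal₂]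
  rfl

theorem proj₁_apply (x : Plane) : proj₁ x = tangentPart normal₁ x := by
  simp only [proj₁, line₁_eq, tangentPart_eq_starProjection norm_normal₁]

theorem proj₂_apply (θ : ℝ) (x : Plane) : proj₂ θ x = tangentPart (normal₂ θ) x := by
  simp only [proj₂, line₂_eq, tangentPart_eq_starProjection (norm_normal₂ θ)]

end Side

section AlongSide

theorem IsMotionOn.eventually_inner_pos {E : Type*} [NormedAddCommGroup E] [InnerProductSpace ℝ E]
    {F : E → E → E} {u v : ℝ → E} {n : E} {a b : ℝ} (hab : a < b)
    (h : IsMotionOn F (Set.Icc a b) u v) (hn : 0 ≤ ⟪n, u a⟫_ℝ) (hv : 0 < ⟪n, v a⟫_ℝ) :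
    ∀ᶠ t in 𝓝[>] a, 0 < ⟪n, u t⟫_ℝ := by
  have hderiv : HasDerivWithinAt (fun t => ⟪n, u t⟫_ℝ) ⟪n, v a⟫_ℝ (Set.Ioc a b) a :=
    ((innerSL ℝ n).hasFDerivAt.comp_hasDerivWithinAt a
      (h.hasDerivWithinAt a (Set.left_mem_Icc.2 hab.le))).mono Set.Ioc_subset_Icc_self
  have hslope := (hasDerivWithinAt_iff_tendsto_slope' (fun ha => lt_irrefl a ha.1)).1 hderiv
  rw [nhdsWithin_Ioc_eq_nhdsGT hab] at hslope
  filter_upwards [hslope.eventually_const_lt hv, self_mem_nhdsWithin] with t ht hat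
  rw [slope_def_field, div_pos_iff_of_pos_right (sub_pos.2 hat)] at ht
  linarith

variable {θ α k a b : ℝ} {n τ x v₀ : Plane} {u v : ℝ → Plane}

theorem IsMotionOn.eqOn_slide_of_isSide (hs : IsSide θ n τ) (hα : 1 < α) (hk : 0 < k)
    (h : IsMotionOn (penaltyForce θ α k) (Set.Icc a b) u v) (hab : a < b) (hn : 0 ≤ ⟪n, u a⟫_ℝ)
    (hv : 0 < ⟪n, v a⟫_ℝ) (hτ : ∀ t ∈ Set.Ico a b, 0 < ⟪τ, u a⟫_ℝ + (t - a) * ⟪τ, v a⟫_ℝ) :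
    Set.EqOn u (fun t => slidePos (slowRate α k) (fastRate α k) n (u a) (v a) (t - a))
        (Set.Icc a b) ∧
      Set.EqOn v (fun t => slideVel (slowRate α k) (fastRate α k) n (u a) (v a) (t - a))
        (Set.Icc a b) := by
  let R : Set Plane := {x | 0 < ⟪n, x⟫_ℝ ∧ 0 < ⟪τ, x⟫_ℝ}
  have hhalf (w : Plane) : IsOpen {x : Plane | 0 < ⟪w, x⟫_ℝ} :=
    isOpen_lt continuous_const (by fun_prop)
  have hopen : IsOpen R := (hhalf n).inter (hhalf τ)
  have hlm := slowRate_lt_fastRate hα hk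
  have hslide {c : ℝ} (hc : c ≤ b) (hR : ∀ s ∈ Set.Ioo a c, u s ∈ R) :=
    ((h.mono (Set.Icc_subset_Icc_right hc)).congr_force Set.ordConnected_Icc fun s hsc =>
      have hsR := hR s (interior_Icc.subset hsc)
      hs.penaltyForce_eq hα hk.le hsR.1 hsR.2.le (v s)).eqOn_slide hlm.ne hs.norm_normal
  have hstart : ∀ᶠ t in 𝓝[>] a, u t ∈ R := by
    have hτa : 0 < ⟪τ, u a⟫_ℝ := by simpa using hτ a ⟨le_rfl, hab⟩
    have hcont : Tendsto (fun t => ⟪τ, u t⟫_ℝ) (𝓝[>] a) (𝓝 ⟪τ, u a⟫_ℝ) :=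
      tendsto_const_nhds.inner (((h.continuousOn_pos a (Set.left_mem_Icc.2 hab.le)).mono
        Set.Ioc_subset_Icc_self).tendsto.mono_left (nhdsWithin_Ioc_eq_nhdsGT hab).ge)
    exact (h.eventually_inner_pos hab hn hv).and (hcont.eventually_const_lt hτa)
  refine hslide le_rfl fun t ht => mem_of_forall_not_first_exit (b := t)
    (h.continuousOn_pos.mono (Set.Icc_subset_Icc_right ht.2.le))
    hopen hstart (fun s hst hR => ?_) t ⟨ht.1, le_rfl⟩
  have hus := (hslide (hst.2.trans ht.2.le) hR).1 (Set.right_mem_Icc.2 hst.1.le)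
  refine ⟨?_, ?_⟩
  · rw [hus, inner_slidePos_normal hs.norm_normal]
    exact dampedPos_pos (slowRate_pos hα hk).le hlm hn hv (sub_pos.2 hst.1)
  · rw [hus, inner_slidePos_tangent hs.inner_tangent_normal]
    exact hτ s ⟨hst.1.le, hst.2.trans_lt ht.2⟩

theorem IsSide.isMotionOn_slide (hs : IsSide θ n τ) (hα : 1 < α) (hk : 0 < k)
    (hn : 0 ≤ ⟪n, x⟫_ℝ) (hv : 0 < ⟪n, v₀⟫_ℝ) {S : Set ℝ} (hS : S.OrdConnected)
    (hτ : ∀ t ∈ interior S, a < t ∧ 0 ≤ ⟪τ, x⟫_ℝ + (t - a) * ⟪τ, v₀⟫_ℝ) :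
    IsMotionOn (penaltyForce θ α k) S
      (fun t => slidePos (slowRate α k) (fastRate α k) n x v₀ (t - a))
      (fun t => slideVel (slowRate α k) (fastRate α k) n x v₀ (t - a)) := by
  have hlm := slowRate_lt_fastRate hα hk
  refine (CornerImpact.isMotionOn_slide hlm.ne hs.norm_normal a x v₀ hS).congr_force hS
    fun t ht => (hs.penaltyForce_eq hα hk.le ?_ ?_ _).symm
  · rw [inner_slidePos_normal hs.norm_normal]
    exact dampedPos_pos (slowRate_pos hα hk).le hlm hn hv (sub_pos.2 (hτ t ht).1)
  · rw [inner_slidePos_tangent hs.inner_tangent_normal]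
    exact (hτ t ht).2

/-- The states from which a motion slides along the side `(n, τ)` away from the apex: the position
and the velocity both have positive components along `n` and along `τ`. -/
def launchSet (n τ : Plane) : Set (Plane × Plane) :=
  {p | (0 < ⟪n, p.1⟫_ℝ ∧ 0 < ⟪τ, p.1⟫_ℝ) ∧ 0 < ⟪n, p.2⟫_ℝ ∧ 0 < ⟪τ, p.2⟫_ℝ}

theorem isOpen_launchSet (n τ : Plane) : IsOpen (launchSet n τ) :=
  have hpos {f : Plane × Plane → ℝ} (hf : Continuous f) : IsOpen {p | 0 < f p} :=
    isOpen_lt continuous_const hf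
  ((hpos (by fun_prop)).inter (hpos (by fun_prop))).inter
    ((hpos (by fun_prop)).inter (hpos (by fun_prop)))

theorem smul_mem_launchSet_iff {c : ℝ} (hc : 0 < c) {y w : Plane} :
    (c • y, w) ∈ launchSet n τ ↔ (y, w) ∈ launchSet n τ := by
  simp only [launchSet, Set.mem_ofPred_eq, inner_smul_right, mul_pos_iff_of_pos_left hc]

theorem IsMotionOn.eqOn_slide_of_mem_launchSet (hs : IsSide θ n τ) (hα : 1 < α) (hk : 0 < k)
    (h : IsMotionOn (penaltyForce θ α k) (Set.Ici a) u v) (hlaunch : (u a, v a) ∈ launchSet n τ) :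
    Set.EqOn u (fun t => slidePos (slowRate α k) (fastRate α k) n (u a) (v a) (t - a))
      (Set.Ici a) := fun t ht =>
  ((h.mono Set.Icc_subset_Ici_self).eqOn_slide_of_isSide hs hα hk
    ((Set.mem_Ici.1 ht).trans_lt (lt_add_one t)) hlaunch.1.1.le hlaunch.2.1 fun _ hsa =>
      add_pos_of_pos_of_nonneg hlaunch.1.2 (mul_nonneg (sub_nonneg.2 hsa.1) hlaunch.2.2.le)).1
    ⟨ht, (lt_add_one t).le⟩

theorem IsSide.exists_isMotionOn_of_mem_launchSet (hs : IsSide θ n τ) (hα : 1 < α) (hk : 0 < k)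
    (hlaunch : (x, v₀) ∈ launchSet n τ) (a : ℝ) :
    ∃ u v, IsMotionOn (penaltyForce θ α k) (Set.Ici a) u v ∧ u a = x ∧ v a = v₀ :=
  ⟨_, _, hs.isMotionOn_slide hα hk hlaunch.1.1.le hlaunch.2.1 Set.ordConnected_Ici fun t ht =>
    have hat : a < t := interior_Ici.subset ht
    ⟨hat, add_nonneg hlaunch.1.2.le (mul_nonneg (sub_nonneg.2 hat.le) hlaunch.2.2.le)⟩,
    by simp only [sub_self, slidePos_zero], by simp only [sub_self, slideVel_zero]⟩

end AlongSide

section Crossing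

variable {θ α k a b σ : ℝ} {n τ x₀ v₀ : Plane}

theorem IsSide.exists_isMotionOn_of_inner_pos (hs : IsSide θ n τ) (hα : 0 ≤ α) (hk : 0 ≤ k)
    (hab : a < b) (hσ : 0 < σ) (hpos : (b - a) * (|⟪n, v₀⟫_ℝ| + σ) < ⟪n, x₀⟫_ℝ)
    (hforce : (b - a) * tubeForce (2 * α * √k) k (b - a) σ ‖x₀‖ ‖v₀‖ ≤ σ) :
    ∃ u v, IsMotionOn (penaltyForce θ α k) (Set.Icc a b) u v ∧ u a = x₀ ∧ v a = v₀ := by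
  have hdist : ∀ p ∈ tube (b - a) σ x₀ v₀,
      ⟪n, x₀⟫_ℝ - (b - a) * (|⟪n, v₀⟫_ℝ| + σ) ≤ ‖p.1 - projCone θ p.1‖ := by
    rintro p ⟨t, ht, hp, -⟩
    refine le_trans ?_ (hs.inner_sub_le_norm p.1 (projCone_mem θ p.1))
    have hdrift : -((b - a) * |⟪n, v₀⟫_ℝ|) ≤ t * ⟪n, v₀⟫_ℝ := by
      refine neg_le_of_abs_le ?_
      rw [abs_mul, abs_of_nonneg ht.1]
      exact mul_le_mul_of_nonneg_right ht.2 (abs_nonneg _)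
    have herror := (abs_real_inner_le_norm n (p.1 - (x₀ + t • v₀))).trans_eq
      (by rw [hs.norm_normal, one_mul])
    rw [inner_sub_right, inner_add_right, inner_smul_right] at herror
    linarith [neg_le_of_abs_le herror]
  obtain ⟨K, hK⟩ := exists_lipschitzOnWith_penaltyForce (M := ‖v₀‖ + σ) hα hk (sub_pos.2 hpos)
    hdist fun p ⟨_, _, _, hp⟩ => by linarith [norm_sub_norm_le p.2 v₀]
  exact exists_isMotionOn_of_lipschitzOnWith_tube hab hσ hK
    (fun p => norm_force_le_tubeForce (by positivity) hk (norm_penaltyForce_le hα hk θ)) hforce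

theorem tendsto_mul_tubeForce {ε s : ℝ → ℝ} {s₀ : ℝ}
    (hε : Tendsto (fun k => √k * ε k) atTop (𝓝 0)) (hs : Tendsto s atTop (𝓝 s₀)) (α ℓ σ : ℝ) :
    Tendsto (fun k => ℓ * ε k * tubeForce (2 * α * √k) k (ℓ * ε k) σ (ε k) (s k)) atTop (𝓝 0) := by
  have hlim : Tendsto (fun k => ℓ * (√k * ε k) * (2 * α * (s k + σ))
      + ℓ * (√k * ε k) ^ 2 * (1 + ℓ * (s k + σ))) atTop (𝓝 0) := by
    have h := (((hε.const_mul ℓ).mul ((hs.add_const σ).const_mul (2 * α))).add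
      (((hε.pow 2).const_mul ℓ).mul (((hs.add_const σ).const_mul ℓ).const_add 1)))
    simpa using h
  refine hlim.congr' ((eventually_ge_atTop 0).mono fun k hk => ?_)
  unfold tubeForce
  linear_combination ℓ * ε k ^ 2 * (1 + ℓ * (s k + σ)) * Real.sq_sqrt hk

variable {ε : ℝ → ℝ} {v₀ : ℝ → Plane} {w : Plane} {ℓ : ℝ}

theorem IsSide.eventually_exists_isMotionOn_crossing (hs : IsSide θ n τ) (hα : 0 ≤ α)
    (hε : Tendsto (fun k => √k * ε k) atTop (𝓝 0)) (hεpos : ∀ᶠ k in atTop, 0 < ε k)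
    (hv₀ : Tendsto v₀ atTop (𝓝 w)) (hw : ⟪n, w⟫_ℝ = 0) (hℓ : 0 < ℓ) (a : ℝ) :
    ∀ᶠ k in atTop, ∃ u v, IsMotionOn (penaltyForce θ α k) (Set.Icc a (a + ℓ * ε k)) u v ∧
      u a = ε k • n ∧ v a = v₀ k := by
  have hσ : 0 < 1 / (4 * ℓ) := by positivity
  have hnormal : Tendsto (fun k => |⟪n, v₀ k⟫_ℝ|) atTop (𝓝 0) := by
    simpa only [hw, abs_zero] using ((tendsto_const_nhds (x := n)).inner (𝕜 := ℝ) hv₀).abs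
  filter_upwards [eventually_ge_atTop 0, hεpos, hnormal.eventually_lt_const hσ,
    (tendsto_mul_tubeForce hε hv₀.norm α ℓ (1 / (4 * ℓ))).eventually_le_const hσ]
    with k hk hε hnormal hforce
  refine hs.exists_isMotionOn_of_inner_pos hα hk (lt_add_of_pos_right a (by positivity)) hσ ?_ ?_
  · rw [add_sub_cancel_left, inner_smul_right, inner_self_eq_one_of_norm_eq_one hs.norm_normal]
    calc ℓ * ε k * (|⟪n, v₀ k⟫_ℝ| + 1 / (4 * ℓ))
        ≤ ℓ * ε k * (1 / (4 * ℓ) + 1 / (4 * ℓ)) := by gcongr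
      _ = ε k / 2 := by field_simp; norm_num
      _ < ε k * 1 := by linarith
  · rwa [add_sub_cancel_left, norm_smul, hs.norm_normal, mul_one, Real.norm_of_nonneg hε.le]

theorem eventually_norm_crossing_vel_sub_lt (hn : ‖n‖ = 1) (hα : 0 ≤ α)
    (hε : Tendsto (fun k => √k * ε k) atTop (𝓝 0)) (hεpos : ∀ᶠ k in atTop, 0 < ε k)
    (hv₀ : Tendsto v₀ atTop (𝓝 w)) (ℓ a : ℝ) {δ : ℝ} (hδ : 0 < δ) :
    ∀ᶠ k in atTop, ∀ u v, IsMotionOn (penaltyForce θ α k) (Set.Icc a (a + ℓ * ε k)) u v →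
      u a = ε k • n → v a = v₀ k → ∀ t ∈ Set.Icc a (a + ℓ * ε k), ‖v t - w‖ < δ := by
  filter_upwards [eventually_ge_atTop 0, hεpos,
    (tendsto_iff_norm_sub_tendsto_zero.1 hv₀).eventually_lt_const (half_pos hδ),
    (tendsto_mul_tubeForce hε hv₀.norm α ℓ (δ / 2)).eventually_lt_const (half_pos hδ)]
    with k hk hε hinit hforce u v h hu hv t ht
  have hmove : ‖v t - v a‖ < δ / 2 :=
    h.norm_vel_sub_lt (by positivity) hk (norm_penaltyForce_le hα hk θ) (half_pos hδ)
      (by rwa [add_sub_cancel_left, hu, hv, norm_smul, hn, mul_one, Real.norm_of_nonneg hε.le]) t ht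
  rw [hv] at hmove
  linarith [norm_sub_le_norm_sub_add_norm_sub (v t) (v₀ k) w]

theorem eventually_crossing_mem_launchSet (hn : ‖n‖ = 1) (hα : 0 ≤ α)
    (hε : Tendsto (fun k => √k * ε k) atTop (𝓝 0)) (hεpos : ∀ᶠ k in atTop, 0 < ε k)
    (hv₀ : Tendsto v₀ atTop (𝓝 w)) (hℓ : 0 < ℓ) {n' τ' : Plane}
    (hlaunch : (n + ℓ • w, w) ∈ launchSet n' τ') (a : ℝ) :
    ∀ᶠ k in atTop, ∀ u v, IsMotionOn (penaltyForce θ α k) (Set.Icc a (a + ℓ * ε k)) u v →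
      u a = ε k • n → v a = v₀ k →
        (u (a + ℓ * ε k), v (a + ℓ * ε k)) ∈ launchSet n' τ' := by
  obtain ⟨r, hr, hball⟩ := Metric.isOpen_iff.1 (isOpen_launchSet n' τ') _ hlaunch
  have hδ : 0 < r / (1 + ℓ) := by positivity
  filter_upwards [hεpos, eventually_norm_crossing_vel_sub_lt hn hα hε hεpos hv₀ ℓ a hδ]
    with k hε hvel u v h hu hv
  have hb : a + ℓ * ε k ∈ Set.Icc a (a + ℓ * ε k) :=
    Set.right_mem_Icc.2 (le_add_of_nonneg_right (by positivity))
  have hpos : ‖(ε k)⁻¹ • u (a + ℓ * ε k) - (n + ℓ • w)‖ ≤ r / (1 + ℓ) * ℓ := by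
    have hle := h.norm_pos_sub_le
      (fun s hs => (hvel u v h hu hv s (Set.Ico_subset_Icc_self hs)).le) _ hb
    have hscale : u (a + ℓ * ε k) - (ε k • n + (ℓ * ε k) • w)
        = ε k • ((ε k)⁻¹ • u (a + ℓ * ε k) - (n + ℓ • w)) := by
      rw [smul_sub, smul_inv_smul₀ hε.ne']; module
    rw [hu, add_sub_cancel_left, hscale, norm_smul, Real.norm_of_nonneg hε.le, ← mul_assoc,
      mul_comm] at hle
    exact le_of_mul_le_mul_right hle hε
  refine (smul_mem_launchSet_iff (inv_pos.2 hε)).1 (hball ?_)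
  rw [mem_ball_iff_norm, Prod.norm_def, max_lt_iff]
  refine ⟨hpos.trans_lt ?_, (hvel u v h hu hv _ hb).trans ?_⟩
  · rw [div_mul_eq_mul_div, div_lt_iff₀ (by positivity)]; linarith
  · exact div_lt_self hr (by linarith)

end Crossing

section Gap

/-- The distance from the side at time `t` of a motion that leaves this side at time `0` with
outward normal speed `p`. -/
noncomputable def gap (α k p t : ℝ) : ℝ := dampedPos (slowRate α k) (fastRate α k) 0 p t

/-- The velocity of `gap`. -/
noncomputable def gapVel (α k p t : ℝ) : ℝ := dampedVel (slowRate α k) (fastRate α k) 0 p t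

variable {α k p t : ℝ}

theorem gap_pos (hα : 1 < α) (hk : 0 < k) (hp : 0 < p) (ht : 0 < t) : 0 < gap α k p t :=
  dampedPos_pos (slowRate_pos hα hk).le (slowRate_lt_fastRate hα hk) le_rfl hp ht

theorem tendsto_exp_neg_mul_sqrt {c : ℝ} (hc : 0 < c) :
    Tendsto (fun k => Real.exp (-(c * √k))) atTop (𝓝 0) :=
  Real.tendsto_exp_neg_atTop_nhds_zero.comp (Real.tendsto_sqrt_atTop.const_mul_atTop hc)

theorem tendsto_sqrt_mul_gap (hα : 1 < α) (hp : 0 < p) (ht : 0 < t) :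
    Tendsto (fun k => √k * gap α k p t) atTop (𝓝 0) := by
  have hβ := sqrt_sq_sub_one_pos hα
  have hc : 0 < (α - √(α ^ 2 - 1)) * t := mul_pos (sub_pos.2 (sqrt_sq_sub_one_lt hα)) ht
  have hlim := (tendsto_exp_neg_mul_sqrt hc).const_mul (p / (2 * √(α ^ 2 - 1)))
  rw [mul_zero] at hlim
  refine squeeze_zero' ?_ ?_ hlim <;> filter_upwards [eventually_gt_atTop 0] with k hk
  · exact mul_nonneg (Real.sqrt_nonneg k) (gap_pos hα hk hp ht).le
  · have hgap : gap α k p t ≤ p / (2 * √(α ^ 2 - 1) * √k) * Real.exp (-slowRate α k * t) := by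
      simpa only [gap, fastRate_sub_slowRate, mul_zero, add_zero, zero_add] using
        dampedPos_le (t := t) (slowRate_pos hα hk).le (slowRate_lt_fastRate hα hk) le_rfl hp.le
    have hexp : -slowRate α k * t = -((α - √(α ^ 2 - 1)) * t * √k) := by unfold slowRate; ring
    have := Real.sqrt_pos.2 hk
    calc √k * gap α k p t
        ≤ √k * (p / (2 * √(α ^ 2 - 1) * √k) * Real.exp (-slowRate α k * t)) := by gcongr
      _ = p / (2 * √(α ^ 2 - 1)) * Real.exp (-((α - √(α ^ 2 - 1)) * t * √k)) := by
          rw [hexp]; field_simp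

theorem tendsto_gap (hα : 1 < α) (hp : 0 < p) (ht : 0 < t) :
    Tendsto (fun k => gap α k p t) atTop (𝓝 0) := by
  refine squeeze_zero' ?_ ?_ (tendsto_sqrt_mul_gap hα hp ht)
  · filter_upwards [eventually_gt_atTop 0] with k hk using (gap_pos hα hk hp ht).le
  · filter_upwards [eventually_ge_atTop 1] with k hk
    exact le_mul_of_one_le_left (gap_pos hα (by linarith) hp ht).le (Real.one_le_sqrt.2 hk)

theorem tendsto_gapVel (hα : 1 < α) (hp : 0 < p) (ht : 0 < t) :
    Tendsto (fun k => gapVel α k p t) atTop (𝓝 0) := by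
  have hc : 0 < (α + √(α ^ 2 - 1)) * t := mul_pos (by linarith [sqrt_sq_sub_one_pos hα]) ht
  have hlim := ((tendsto_exp_neg_mul_sqrt hc).const_mul p).sub
    ((tendsto_sqrt_mul_gap hα hp ht).const_mul (α - √(α ^ 2 - 1)))
  rw [mul_zero, mul_zero, sub_zero] at hlim
  refine hlim.congr fun k => ?_
  have hexp : -fastRate α k * t = -((α + √(α ^ 2 - 1)) * t * √k) := by unfold fastRate; ring
  rw [gapVel, dampedVel, hexp, gap, slowRate]
  ring

end Gap

section Approach

variable {θ α k t₀ ℓ : ℝ} {n τ n' τ' x₀ v₀ : Plane} {u v : ℝ → Plane}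

/-- A point that starts at `x₀` on the side `(n, τ)` with velocity `v₀` is pushed off this side, and
its projection to the side reaches the apex at time `t₀`. -/
structure Approaches (n τ x₀ v₀ : Plane) (t₀ : ℝ) : Prop where
  inner_normal_eq_zero : ⟪n, x₀⟫_ℝ = 0
  inner_tangent_pos : 0 < ⟪τ, x₀⟫_ℝ
  inner_normal_vel_pos : 0 < ⟪n, v₀⟫_ℝ
  time_pos : 0 < t₀
  arrival : x₀ + t₀ • tangentPart n v₀ = 0

namespace Approaches

theorem inner_tangent_motion (h : Approaches n τ x₀ v₀ t₀) (hs : IsSide θ n τ) (t : ℝ) :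
    ⟪τ, x₀⟫_ℝ + t * ⟪τ, v₀⟫_ℝ = (t₀ - t) / t₀ * ⟪τ, x₀⟫_ℝ := by
  have harrival : ⟪τ, x₀⟫_ℝ + t₀ * ⟪τ, v₀⟫_ℝ = 0 := by
    rw [← inner_tangentPart_of_inner_eq_zero hs.inner_tangent_normal v₀, ← inner_smul_right,
      ← inner_add_right, h.arrival, inner_zero_right]
  have ht₀ := h.time_pos.ne'
  field_simp
  linear_combination t * harrival

theorem slidePos_eq (h : Approaches n τ x₀ v₀ t₀) (t : ℝ) :
    slidePos (slowRate α k) (fastRate α k) n x₀ v₀ t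
      = gap α k ⟪n, v₀⟫_ℝ t • n + (x₀ + t • tangentPart n v₀) := by
  rw [slidePos, h.inner_normal_eq_zero, tangentPart_of_inner_eq_zero h.inner_normal_eq_zero, gap]

theorem slidePos_arrival (h : Approaches n τ x₀ v₀ t₀) :
    slidePos (slowRate α k) (fastRate α k) n x₀ v₀ t₀ = gap α k ⟪n, v₀⟫_ℝ t₀ • n := by
  rw [h.slidePos_eq, h.arrival, add_zero]

theorem slideVel_eq (h : Approaches n τ x₀ v₀ t₀) (t : ℝ) :
    slideVel (slowRate α k) (fastRate α k) n x₀ v₀ t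
      = gapVel α k ⟪n, v₀⟫_ℝ t • n + tangentPart n v₀ := by
  rw [slideVel, h.inner_normal_eq_zero, gapVel]

theorem eqOn_slide (h : Approaches n τ x₀ v₀ t₀) (hs : IsSide θ n τ) (hα : 1 < α) (hk : 0 < k)
    (hmotion : IsMotionOn (penaltyForce θ α k) (Set.Ici 0) u v) (hu : u 0 = x₀) (hv : v 0 = v₀) :
    Set.EqOn u (slidePos (slowRate α k) (fastRate α k) n x₀ v₀) (Set.Icc 0 t₀) ∧
      Set.EqOn v (slideVel (slowRate α k) (fastRate α k) n x₀ v₀) (Set.Icc 0 t₀) := by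
  subst hu hv
  simpa only [sub_zero] using (hmotion.mono Set.Icc_subset_Ici_self).eqOn_slide_of_isSide hs hα hk
    h.time_pos h.inner_normal_eq_zero.ge h.inner_normal_vel_pos fun t ht => by
      rw [sub_zero, h.inner_tangent_motion hs]
      exact mul_pos (div_pos (sub_pos.2 ht.2) h.time_pos) h.inner_tangent_pos

theorem isMotionOn_slide (h : Approaches n τ x₀ v₀ t₀) (hs : IsSide θ n τ) (hα : 1 < α)
    (hk : 0 < k) :
    IsMotionOn (penaltyForce θ α k) (Set.Icc 0 t₀) (slidePos (slowRate α k) (fastRate α k) n x₀ v₀)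
      (slideVel (slowRate α k) (fastRate α k) n x₀ v₀) := by
  simpa only [sub_zero] using hs.isMotionOn_slide (a := 0) hα hk h.inner_normal_eq_zero.ge
    h.inner_normal_vel_pos Set.ordConnected_Icc fun t ht => by
      obtain ⟨ht, htt₀⟩ := interior_Icc.subset ht
      rw [sub_zero, h.inner_tangent_motion hs]
      exact ⟨ht, mul_nonneg (div_pos (sub_pos.2 htt₀) h.time_pos).le h.inner_tangent_pos.le⟩

theorem tangentPart_vel_arrival (h : Approaches n τ x₀ v₀ t₀) (hs : IsSide θ n τ) (hα : 1 < α)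
    (hk : 0 < k) (hmotion : IsMotionOn (penaltyForce θ α k) (Set.Ici 0) u v) (hu : u 0 = x₀)
    (hv : v 0 = v₀) : tangentPart n (v t₀) = tangentPart n v₀ := by
  rw [(h.eqOn_slide hs hα hk hmotion hu hv).2 (Set.right_mem_Icc.2 h.time_pos.le), tangentPart,
    inner_slideVel_normal hs.norm_normal, slideVel, add_sub_cancel_left]

theorem tendsto_vel_arrival (h : Approaches n τ x₀ v₀ t₀) (hα : 1 < α) :
    Tendsto (fun k => slideVel (slowRate α k) (fastRate α k) n x₀ v₀ t₀) atTop
      (𝓝 (tangentPart n v₀)) := by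
  simp only [h.slideVel_eq]
  simpa only [zero_smul, zero_add] using
    ((tendsto_gapVel hα h.inner_normal_vel_pos h.time_pos).smul_const n).add_const
      (tangentPart n v₀)

theorem eventually_gap_pos (h : Approaches n τ x₀ v₀ t₀) (hα : 1 < α) :
    ∀ᶠ k in atTop, 0 < gap α k ⟪n, v₀⟫_ℝ t₀ :=
  (eventually_gt_atTop 0).mono fun _ hk => gap_pos hα hk h.inner_normal_vel_pos h.time_pos

theorem eventually_exists_isMotionOn (h : Approaches n τ x₀ v₀ t₀) (hs : IsSide θ n τ)
    (hs' : IsSide θ n' τ') (hα : 1 < α) (hℓ : 0 < ℓ)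
    (hlaunch : (n + ℓ • tangentPart n v₀, tangentPart n v₀) ∈ launchSet n' τ') :
    ∀ᶠ k in atTop, ∃ u v,
      IsMotionOn (penaltyForce θ α k) (Set.Ici 0) u v ∧ u 0 = x₀ ∧ v 0 = v₀ := by
  have hα₀ : 0 ≤ α := zero_le_one.trans hα.le
  have hgap := tendsto_sqrt_mul_gap hα h.inner_normal_vel_pos h.time_pos
  filter_upwards [eventually_gt_atTop 0, h.eventually_gap_pos hα,
    hs.eventually_exists_isMotionOn_crossing hα₀ hgap (h.eventually_gap_pos hα)
      (h.tendsto_vel_arrival hα) (inner_tangentPart_self hs.norm_normal v₀) hℓ t₀,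
    eventually_crossing_mem_launchSet hs.norm_normal hα₀ hgap (h.eventually_gap_pos hα)
      (h.tendsto_vel_arrival hα) hℓ hlaunch t₀]
    with k hk hgap ⟨u₁, v₁, hcross, hu₁, hv₁⟩ hmem
  obtain ⟨u₂, v₂, hleave, hu₂, hv₂⟩ := hs'.exists_isMotionOn_of_mem_launchSet hα hk
    (hmem u₁ v₁ hcross hu₁ hv₁) (t₀ + ℓ * gap α k ⟪n, v₀⟫_ℝ t₀)
  obtain ⟨u₃, v₃, hafter, hu₃, hv₃⟩ :=
    hcross.exists_extend (le_add_of_nonneg_right (by positivity)) hleave hu₂ hv₂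
  obtain ⟨u, v, hmotion, hu, hv⟩ := (h.isMotionOn_slide hs hα hk).exists_extend h.time_pos.le hafter
    (by rw [hu₃, hu₁, h.slidePos_arrival]) (by rw [hv₃, hv₁])
  exact ⟨u, v, hmotion, by rw [hu, slidePos_zero], by rw [hv, slideVel_zero]⟩

end Approaches
end Approach

section Convergence

theorem fastRate_div_fastRate_sub_slowRate {α k : ℝ} (hk : 0 < k) :
    fastRate α k / (fastRate α k - slowRate α k)
      = (α + √(α ^ 2 - 1)) / (2 * √(α ^ 2 - 1)) := by
  rw [fastRate_sub_slowRate, fastRate, mul_div_mul_right _ _ (Real.sqrt_pos.2 hk).ne']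

theorem tendsto_div_fastRate_sub_slowRate {α : ℝ} (hα : 1 < α) (c : ℝ) :
    Tendsto (fun k => c / (fastRate α k - slowRate α k)) atTop (𝓝 0) := by
  have hβ := sqrt_sq_sub_one_pos hα
  simp only [fastRate_sub_slowRate]
  exact (Real.tendsto_sqrt_atTop.const_mul_atTop (by positivity)).const_div_atTop c

variable {θ α k a b t₀ ℓ : ℝ} {n τ n' τ' w x₀ v₀ : Plane} {u v : ℝ → Plane}

theorem IsMotionOn.norm_sub_tangentPart_le_of_mem_launchSet (hs : IsSide θ n τ) (hα : 1 < α)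
    (hk : 0 < k) (h : IsMotionOn (penaltyForce θ α k) (Set.Ici a) u v)
    (hlaunch : (u a, v a) ∈ launchSet n τ) {t : ℝ} (ht : a ≤ t) :
    ‖u t - (tangentPart n (u a) + (t - a) • tangentPart n (v a))‖
      ≤ fastRate α k / (fastRate α k - slowRate α k) * ‖u a‖
        + ‖v a‖ / (fastRate α k - slowRate α k) := by
  have hl := slowRate_pos hα hk
  have hlm := slowRate_lt_fastRate hα hk
  have : 0 < fastRate α k - slowRate α k := sub_pos.2 hlm
  have hm : 0 < fastRate α k := hl.trans hlm
  have hinner (z : Plane) : ⟪n, z⟫_ℝ ≤ ‖z‖ := by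
    simpa only [hs.norm_normal, one_mul] using real_inner_le_norm n z
  have hslide : u t = slidePos (slowRate α k) (fastRate α k) n (u a) (v a) (t - a) :=
    h.eqOn_slide_of_mem_launchSet hs hα hk hlaunch ht
  rw [hslide]
  refine (norm_slidePos_sub_le hl.le hlm hs.norm_normal hlaunch.1.1.le hlaunch.2.1
    (sub_nonneg.2 ht)).trans ?_
  gcongr <;> exact hinner _

theorem IsMotionOn.norm_sub_smul_tangentPart_le (hs : IsSide θ n τ) (hα : 1 < α) (hk : 0 < k)
    (h : IsMotionOn (penaltyForce θ α k) (Set.Ici a) u v) (hab : a ≤ b)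
    (hlaunch : (u b, v b) ∈ launchSet n τ) {δ : ℝ} (hδ : 0 ≤ δ)
    (hv : ∀ t ∈ Set.Icc a b, ‖v t - w‖ ≤ δ) {t : ℝ} (ht : a ≤ t) :
    ‖u t - (t - a) • tangentPart n w‖
      ≤ (2 + fastRate α k / (fastRate α k - slowRate α k)) * (‖u a‖ + (b - a) * (‖w‖ + δ))
        + (‖w‖ + δ) / (fastRate α k - slowRate α k) + δ * (t - a) := by
  have hlm := slowRate_lt_fastRate hα hk
  have hml : 0 < fastRate α k - slowRate α k := sub_pos.2 hlm
  have hm : 0 < fastRate α k := (slowRate_pos hα hk).trans hlm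
  set ρ := ‖u a‖ + (b - a) * (‖w‖ + δ)
  have hba : 0 ≤ b - a := sub_nonneg.2 hab
  have hρ {s : ℝ} (hsab : s ∈ Set.Icc a b) : ‖u s‖ ≤ ρ :=
    (h.mono Set.Icc_subset_Ici_self).norm_le_of_norm_vel_sub_le hv hδ hsab
  have hw : (b - a) * ‖w‖ ≤ ρ := by
    have : (b - a) * ‖w‖ ≤ (b - a) * (‖w‖ + δ) := by gcongr; linarith
    linarith [norm_nonneg (u a)]
  rcases le_total t b with htb | hbt
  · have hdrift : ‖(t - a) • tangentPart n w‖ ≤ ρ := by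
      rw [norm_smul, Real.norm_of_nonneg (sub_nonneg.2 ht)]
      exact le_trans (by gcongr; exact norm_tangentPart_le hs.norm_normal w) hw
    have hrest : 0 ≤ fastRate α k / (fastRate α k - slowRate α k) * ρ
        + (‖w‖ + δ) / (fastRate α k - slowRate α k) + δ * (t - a) := by
      have := sub_nonneg.2 ht
      positivity
    linarith [norm_sub_le (u t) ((t - a) • tangentPart n w), hρ ⟨ht, htb⟩]
  · have hb : b ∈ Set.Icc a b := Set.right_mem_Icc.2 hab
    have hvb : ‖v b‖ ≤ ‖w‖ + δ := by linarith [norm_sub_norm_le (v b) w, hv b hb]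
    have hleave := ((h.mono (Set.Ici_subset_Ici.2 hab)).norm_sub_tangentPart_le_of_mem_launchSet hs
      hα hk hlaunch hbt).trans (add_le_add (mul_le_mul_of_nonneg_left (hρ hb) (by positivity))
        (div_le_div_of_nonneg_right hvb hml.le))
    have hdrift :=
      norm_tangentPart_motion_sub_le hs.norm_normal (u b) (v b) w (sub_nonneg.2 hbt) hba
    rw [sub_add_sub_cancel] at hdrift
    have hvel : (t - b) * ‖v b - w‖ ≤ δ * (t - a) := by
      rw [mul_comm]
      gcongr
      exact hv b hb
    linarith [norm_sub_le_norm_sub_add_norm_sub (u t)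
      (tangentPart n (u b) + (t - b) • tangentPart n (v b)) ((t - a) • tangentPart n w), hρ hb]

namespace Approaches

theorem eventually_norm_sub_le_before (h : Approaches n τ x₀ v₀ t₀) (hs : IsSide θ n τ)
    (hα : 1 < α) {δ : ℝ} (hδ : 0 < δ) :
    ∀ᶠ k in atTop, ∀ u v, IsMotionOn (penaltyForce θ α k) (Set.Ici 0) u v → u 0 = x₀ → v 0 = v₀ →
      ∀ t ∈ Set.Icc 0 t₀, ‖u t - (x₀ + t • tangentPart n v₀)‖ ≤ δ := by
  filter_upwards [eventually_gt_atTop 0,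
    (tendsto_div_fastRate_sub_slowRate hα ⟪n, v₀⟫_ℝ).eventually_le_const hδ]
    with k hk hle u v hmotion hu hv t ht
  have hslide := norm_slidePos_sub_le (slowRate_pos hα hk).le (slowRate_lt_fastRate hα hk)
    hs.norm_normal h.inner_normal_eq_zero.ge h.inner_normal_vel_pos ht.1
  rw [h.inner_normal_eq_zero, mul_zero, zero_add,
    tangentPart_of_inner_eq_zero h.inner_normal_eq_zero] at hslide
  rw [(h.eqOn_slide hs hα hk hmotion hu hv).1 ht]
  exact hslide.trans hle

theorem eventually_norm_sub_le_after (h : Approaches n τ x₀ v₀ t₀) (hs : IsSide θ n τ)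
    (hs' : IsSide θ n' τ') (hα : 1 < α) (hℓ : 0 < ℓ)
    (hlaunch : (n + ℓ • tangentPart n v₀, tangentPart n v₀) ∈ launchSet n' τ') {δ : ℝ}
    (hδ : 0 < δ) :
    ∀ᶠ k in atTop, ∀ u v, IsMotionOn (penaltyForce θ α k) (Set.Ici 0) u v → u 0 = x₀ → v 0 = v₀ →
      ∀ t ≥ t₀, ‖u t - (t - t₀) • tangentPart n' (tangentPart n v₀)‖ ≤ δ * (1 + (t - t₀)) := by
  have hα₀ : 0 ≤ α := zero_le_one.trans hα.le
  set w := tangentPart n v₀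
  have hgap := tendsto_sqrt_mul_gap hα h.inner_normal_vel_pos h.time_pos
  have hbound : Tendsto (fun k => (2 + (α + √(α ^ 2 - 1)) / (2 * √(α ^ 2 - 1))) *
      (gap α k ⟪n, v₀⟫_ℝ t₀ + ℓ * gap α k ⟪n, v₀⟫_ℝ t₀ * (‖w‖ + δ))
        + (‖w‖ + δ) / (fastRate α k - slowRate α k)) atTop (𝓝 0) := by
    have hgap := tendsto_gap hα h.inner_normal_vel_pos h.time_pos
    simpa using ((hgap.add ((hgap.const_mul ℓ).mul_const (‖w‖ + δ))).const_mul _).add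
      (tendsto_div_fastRate_sub_slowRate hα (‖w‖ + δ))
  filter_upwards [eventually_gt_atTop 0, h.eventually_gap_pos hα, hbound.eventually_le_const hδ,
    eventually_norm_crossing_vel_sub_lt (θ := θ) hs.norm_normal hα₀ hgap (h.eventually_gap_pos hα)
      (h.tendsto_vel_arrival hα) ℓ t₀ hδ,
    eventually_crossing_mem_launchSet (θ := θ) hs.norm_normal hα₀ hgap (h.eventually_gap_pos hα)
      (h.tendsto_vel_arrival hα) hℓ hlaunch t₀]
    with k hk hε hbound hvel hmem u v hmotion hu hv t ht
  have hslide := h.eqOn_slide hs hα hk hmotion hu hv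
  have ht₀ : t₀ ∈ Set.Icc 0 t₀ := Set.right_mem_Icc.2 h.time_pos.le
  have hut₀ := (hslide.1 ht₀).trans h.slidePos_arrival
  have hafter := hmotion.mono (Set.Ici_subset_Ici.2 h.time_pos.le)
  have hcross : IsMotionOn (penaltyForce θ α k) (Set.Icc t₀ (t₀ + ℓ * gap α k ⟪n, v₀⟫_ℝ t₀)) u v :=
    hafter.mono Set.Icc_subset_Ici_self
  have hle := hafter.norm_sub_smul_tangentPart_le hs' hα hk
    (le_add_of_nonneg_right (mul_nonneg hℓ.le hε.le)) (hmem u v hcross hut₀ (hslide.2 ht₀)) hδ.le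
    (fun s hst => (hvel u v hcross hut₀ (hslide.2 ht₀) s hst).le) ht
  rw [fastRate_div_fastRate_sub_slowRate hk, hut₀, norm_smul, hs.norm_normal, mul_one,
    Real.norm_of_nonneg hε.le, add_sub_cancel_left] at hle
  linarith

theorem tendstoUniformlyOn (h : Approaches n τ x₀ v₀ t₀) (hs : IsSide θ n τ)
    (hs' : IsSide θ n' τ') (hα : 1 < α) (hℓ : 0 < ℓ)
    (hlaunch : (n + ℓ • tangentPart n v₀, tangentPart n v₀) ∈ launchSet n' τ')
    {u : ℝ → ℝ → Plane}
    (hu : ∀ᶠ k in atTop, ∃ v,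
      IsMotionOn (penaltyForce θ α k) (Set.Ici 0) (u k) v ∧ u k 0 = x₀ ∧ v 0 = v₀)
    {S : Set ℝ} (hS : S ⊆ Set.Ici 0) (hbdd : BddAbove S) :
    TendstoUniformlyOn u
      (fun t => if t ≤ t₀ then x₀ + t • tangentPart n v₀
        else (t - t₀) • tangentPart n' (tangentPart n v₀)) atTop S := by
  obtain ⟨b, hb⟩ := hbdd
  rw [Metric.tendstoUniformlyOn_iff]
  intro η hη
  have hδ : 0 < η / (2 * (1 + |b|)) := by positivity
  filter_upwards [hu, h.eventually_norm_sub_le_before hs hα (half_pos hη),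
    h.eventually_norm_sub_le_after hs hs' hα hℓ hlaunch hδ]
    with k ⟨v, hmotion, hx₀, hv₀⟩ hbefore hafter t ht
  rw [dist_comm, dist_eq_norm]
  refine lt_of_le_of_lt ?_ (half_lt_self hη)
  split_ifs with htt₀
  · exact hbefore _ v hmotion hx₀ hv₀ t ⟨hS ht, htt₀⟩
  · calc _ ≤ η / (2 * (1 + |b|)) * (1 + (t - t₀)) :=
          hafter _ v hmotion hx₀ hv₀ t (not_le.1 htt₀).le
      _ ≤ η / (2 * (1 + |b|)) * (1 + |b|) := by
          gcongr
          linarith [hb ht, le_abs_self b, h.time_pos]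
      _ = η / 2 := by field_simp

end Approaches
end Convergence

section Corner

variable {θ x₂ p₁ p₂ : ℝ}

theorem tangentPart_normal₁_pair (a b : ℝ) : tangentPart normal₁ !₂[a, b] = !₂[0, b] := by
  rw [tangentPart, inner_normal₁]
  ext i
  fin_cases i <;> simp [normal₁]

theorem approaches₁ (hx₂ : x₂ < 0) (hp₁ : 0 < p₁) (hp₂ : 0 < p₂) :
    Approaches normal₁ tangent₁ !₂[0, x₂] !₂[p₁, p₂] (-x₂ / p₂) where
  inner_normal_eq_zero := by simp [inner_normal₁]
  inner_tangent_pos := by simpa [inner_tangent₁] using hx₂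
  inner_normal_vel_pos := by simpa [inner_normal₁] using hp₁
  time_pos := div_pos (neg_pos.2 hx₂) hp₂
  arrival := by
    rw [tangentPart_normal₁_pair]
    ext i
    fin_cases i <;> simp [hp₂.ne']

theorem launch_mem_launchSet₂ (hsin : 0 < Real.sin θ) (hcos : 0 < Real.cos θ) (p₁ : ℝ)
    (hp₂ : 0 < p₂) :
    (normal₁ + ((Real.tan θ + 1) / p₂) • tangentPart normal₁ !₂[p₁, p₂],
      tangentPart normal₁ !₂[p₁, p₂]) ∈ launchSet (normal₂ θ) (tangent₂ θ) := by
  have hpos : normal₁ + ((Real.tan θ + 1) / p₂) • !₂[0, p₂] = !₂[1, Real.tan θ + 1] := by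
    ext i
    fin_cases i <;> simp [normal₁, hp₂.ne']
  have hnormal : 0 < Real.cos θ + (Real.tan θ + 1) * Real.sin θ := by
    rw [Real.tan_eq_sin_div_cos]; positivity
  have htangent : 0 < (Real.tan θ + 1) * Real.cos θ - Real.sin θ := by
    rwa [add_mul, one_mul, Real.tan_mul_cos hcos.ne', add_sub_cancel_left]
  rw [tangentPart_normal₁_pair, hpos]
  simpa [launchSet, inner_normal₂, inner_tangent₂, hsin, hcos, hp₂] using
    And.intro hnormal (sub_pos.1 htangent)

end Corner

end CornerImpact

open CornerImpact in
theorem mainTheorem2 (θ α x₂ p₁ p₂ : ℝ) (hθ₀ : 0 < θ) (hθ : θ < Real.pi / 2) (hα : 1 < α)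
    (hx₂ : x₂ < 0) (hp₁ : 0 < p₁) (hp₂ : 0 < p₂) :
    (∀ᶠ k : ℝ in atTop, ∃ w : ℝ → Plane, IsPenaltySolution θ α k !₂[0, x₂] !₂[p₁, p₂] w) ∧
    ∀ u : ℝ → ℝ → Plane,
      (∀ᶠ k : ℝ in atTop, IsPenaltySolution θ α k !₂[0, x₂] !₂[p₁, p₂] (u k)) →
      (∀ᶠ k : ℝ in atTop, proj₁ (deriv (u k) (-x₂ / p₂)) = proj₁ !₂[p₁, p₂]) ∧
      ∀ S : Set ℝ, S ⊆ Set.Ici 0 → IsCompact S →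
        TendstoUniformlyOn u
          (limitMotion θ (-x₂ / p₂) !₂[0, x₂] !₂[p₁, p₂]) atTop S := by
  have hsin : 0 < Real.sin θ := Real.sin_pos_of_pos_of_lt_pi hθ₀ (by linarith [Real.pi_pos])
  have hcos : 0 < Real.cos θ := Real.cos_pos_of_mem_Ioo ⟨by linarith, hθ⟩
  have hside₁ := isSide₁ hsin.le
  have hside₂ := isSide₂ hsin.le
  have happroach := approaches₁ hx₂ hp₁ hp₂
  have hℓ : 0 < (Real.tan θ + 1) / p₂ :=
    div_pos (add_pos (Real.tan_pos_of_pos_of_lt_pi_div_two hθ₀ hθ) one_pos) hp₂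
  have hlaunch := launch_mem_launchSet₂ hsin hcos p₁ hp₂
  simp only [isPenaltySolution_iff]
  refine ⟨happroach.eventually_exists_isMotionOn hside₁ hside₂ hα hℓ hlaunch,
    fun u hu => ⟨?_, fun S hS hcompact => ?_⟩⟩
  · filter_upwards [hu, eventually_gt_atTop 0] with k ⟨v, hmotion, hu₀, hv₀⟩ hk
    simp only [proj₁_apply, hmotion.deriv_pos (Ici_mem_nhds happroach.time_pos)]
    exact happroach.tangentPart_vel_arrival hside₁ hα hk hmotion hu₀ hv₀
  · exact (happroach.tendstoUniformlyOn hside₁ hside₂ hα hℓ hlaunch hu hS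
      hcompact.bddAbove).congr_right fun t _ => by simp only [limitMotion, proj₁_apply, proj₂_apply]
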